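/- **Setting.** Let $K\ge 2$ systems have means $\boldsymbol\theta=(\theta_1,\dots,\theta_K)\in\mathbb R^K$ and known variances $\sigma_i^2>0$, and assume that there is a unique best system $I^*=\arg\max_i\theta_i$. At each time $t=0,1,2,\dots$ an allocation rule selects a system $I_t$ as a (measurable) function of the history $(I_0,Y_{1,I_0},\dots,I_{t-1},Y_{t,I_{t-1}})$ and possibly of exogenous randomness, and then $Y_{t+1,I_t}=\theta_{I_t}+W_{t,I_t}$ is observed, where the noises $W_{t,i}\sim N(0,\sigma_i^2)$ are independent across times and systems and independent of the exogenous randomness. Let $N_{t,i}=\sum_{\ell<t}\mathbf 1(I_\ell=i)$ and $p_{t,i}=N_{t,i}/t$. Let $\Pi_t$ be the posterior distribution of the mean vector under the uninformative prior (independent Gaussians of infinite variance): under $\Pi_t$ the means are independent and the $i$-th one is $N(\theta_{t,i},\sigma_i^2/N_{t,i})$ with $\theta_{t,i}=\frac1{N_{t,i}}\sum_{\ell<t}\mathbf 1(I_\ell=i)Y_{\ell+1,I_\ell}$; as long as some systems have not been sampled, $\Pi_t$-probabilities are understood as limits as $s\to\infty$, with $N(0,s)$ for the means of these systems. Let $\Theta_{I^*}=\{\boldsymbol\vartheta\in\mathbb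 R^K:\vartheta_{I^*}>\vartheta_j\ \forall j\ne I^*\}$. An allocation rule $A^*$ is called asymptotically optimal for $\boldsymbol\theta$ if for every allocation rule $A$, $$\liminf_{t\to\infty}\frac{-\log\Pi_t^{A^*}(\Theta_{I^*}^c)}{-\log\Pi_t^{A}(\Theta_{I^*}^c)}\ge 1\quad\text{with probability one,}$$ where the superscript is the rule that collects the data, and the experiments run with the two rules may be realized jointly in any way on one probability space. **Theorem.** There is a unique probability vector $\boldsymbol p^*=(p_1^*,\dots,p_K^*)$ with all $p_i^*>0$ that satisfies 1. (information balance) for all $i,j\ne I^*$, $$\frac{(\theta_{I^*}-\theta_i)^2}{\sigma_{I^*}^2/p^*_{I^*}+\sigma_i^2/p_i^*}=\frac{(\theta_{I^*}-\theta_j)^2}{\sigma_{I^*}^2/p^*_{I^*}+\sigma_j^2/p_j^*};$$ 2. (stationarity) $$p^*_{I^*}=\sum_{j\ne I^*}h_j\,\frac{p_j^*}{1-h_j},\qquad h_j=\frac{\sigma_{I^*}^2/p^*_{I^*}}{\sigma_{I^*}^2/p^*_{I^*}+\sigma_j^2/p_j^*}.$$ Every allocation rule whose empirical allocation vector $\boldsymbol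 p_t=(p_{t,1},\dots,p_{t,K})$ converges almost surely to $\boldsymbol p^*$ is asymptotically optimal for $\boldsymbol\theta$. -/

import Mathlib

open MeasureTheory ProbabilityTheory Filter Topology
open scoped NNReal ENNReal

noncomputable section

namespace RankingSelection

/-- The data collected during the first `t` steps by sampling from `K` systems: entry `ℓ` is the
pair (system selected at step `ℓ`, performance observed as a result). -/
abbrev History (K t : ℕ) : Type := Fin t → Fin K × ℝ

/-- A non-anticipating, possibly randomized, allocation rule for `K` systems: at each step the next
system is a measurable function of the history so far and of an exogenous random seed.  (The whole
seed is available at every step, so it may contain fresh randomness for each of them.) -/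
structure AllocationRule (K : ℕ) where
  /-- The space of seeds. -/
  Seed : Type
  [seedSpace : MeasurableSpace Seed]
  /-- The distribution of the seed. -/
  seedLaw : Measure Seed
  [seedProb : IsProbabilityMeasure seedLaw]
  /-- The system selected at step `t`, given the seed and the history. -/
  select : (t : ℕ) → Seed → History K t → Fin K
  measurable_select : ∀ t, Measurable fun x : Seed × History K t => select t x.1 x.2

attribute [instance] AllocationRule.seedSpace AllocationRule.seedProb

variable {K : ℕ}

namespace AllocationRule

/-- The sample space of an experiment run with the rule `A`: a seed, and a noise array
`w t i = W_{t,i}`. -/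
abbrev Sample (A : AllocationRule K) : Type := A.Seed × (ℕ → Fin K → ℝ)

/-- The probability measure governing the experiment: the noises `W_{t,i} ∼ N(0, σ_i²)` are
independent across times and systems, and independent of the seed. -/
def law (A : AllocationRule K) (σ : Fin K → ℝ≥0) : Measure A.Sample :=
  A.seedLaw.prod
    (Measure.infinitePi fun _ : ℕ => Measure.pi fun i : Fin K => gaussianReal 0 (σ i ^ 2))

/-- The history of the first `t` steps when the true means are `θ`: at step `t` the rule selects
`I_t` from the seed and the history, and `Y_{t+1} = θ_{I_t} + W_{t,I_t}` is observed. -/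
def history (A : AllocationRule K) (θ : Fin K → ℝ) : (t : ℕ) → A.Sample → History K t
  | 0, _ => Fin.elim0
  | t + 1, ω =>
    Fin.snoc (history A θ t ω)
      (A.select t ω.1 (history A θ t ω),
        θ (A.select t ω.1 (history A θ t ω)) + ω.2 t (A.select t ω.1 (history A θ t ω)))

end AllocationRule

/-- `N_{t,i}`: the number of samples allocated to system `i`. -/
def sampleCount {t : ℕ} (h : History K t) (i : Fin K) : ℕ :=
  (Finset.univ.filter fun ℓ => (h ℓ).1 = i).card

/-- `p_{t,i} = N_{t,i} / t`: the empirical allocation vector. -/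
def empiricalAllocation {t : ℕ} (h : History K t) (i : Fin K) : ℝ :=
  (sampleCount h i : ℝ) / t

/-- `θ_{t,i}`: the sample mean of system `i` (only meaningful if `i` has been sampled). -/
def sampleMean {t : ℕ} (h : History K t) (i : Fin K) : ℝ :=
  (∑ ℓ, if (h ℓ).1 = i then (h ℓ).2 else 0) / (sampleCount h i : ℝ)

/-- The posterior of the mean of system `i`: `N(θ_{t,i}, σ_i² / N_{t,i})` if `i` has been sampled.
A system that has not been sampled keeps its prior, for which the parameter `s` provides the
variance: `N(0, s)`; the uninformative prior corresponds to `s → ∞`. -/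
def posteriorMarginal (σ : Fin K → ℝ≥0) (s : ℝ≥0) {t : ℕ} (h : History K t) (i : Fin K) :
    Measure ℝ :=
  if sampleCount h i = 0 then gaussianReal 0 s
  else gaussianReal (sampleMean h i) (σ i ^ 2 / (sampleCount h i : ℝ≥0))

/-- The mean vectors for which system `b` is uniquely the best. -/
def bestRegion (b : Fin K) : Set (Fin K → ℝ) := {ϑ | ∀ j, j ≠ b → ϑ j < ϑ b}

/-- `Π_t(Θ_bᶜ)`: the posterior probability that `b` is not uniquely the best, the means being
independent under the posterior.  Once all systems have been sampled the expression is constant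
in `s`, and so is just the probability under the product of the `N(θ_{t,i}, σ_i² / N_{t,i})`;
before that, the infinite variance of the unsampled systems is understood as a limit. -/
def posteriorMisidentification (σ : Fin K → ℝ≥0) (b : Fin K) {t : ℕ} (h : History K t) : ℝ≥0∞ :=
  liminf (fun s : ℝ≥0 => (Measure.pi fun i => posteriorMarginal σ s h i) (bestRegion b)ᶜ) atTop

/-- `-log q ∈ [0, ∞]` for a probability `q`, with `-log 0 = ∞`. -/
def negLog (q : ℝ≥0∞) : ℝ≥0∞ := (-ENNReal.log q).toENNReal

/-- The rule `A` is asymptotically optimal at the instance with means `θ`, standard deviations `σ`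
and best system `b`: for every rule `B`,
`liminf_t (-log Π_t^A(Θ_bᶜ)) / (-log Π_t^B(Θ_bᶜ)) ≥ 1` with probability one.  The experiments run
with `A` and with `B` may be realized together in any way whatsoever (for instance with common
noise, or independently of each other), that is, `Q` is any coupling of their laws. -/
def IsAsymptoticallyOptimal (θ : Fin K → ℝ) (σ : Fin K → ℝ≥0) (b : Fin K)
    (A : AllocationRule K) : Prop :=
  ∀ (B : AllocationRule K) (Q : Measure (A.Sample × B.Sample)),
    Q.fst = A.law σ → Q.snd = B.law σ →
    ∀ᵐ ω ∂Q, 1 ≤ liminf (fun t : ℕ =>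
      negLog (posteriorMisidentification σ b (A.history θ t ω.1)) /
        negLog (posteriorMisidentification σ b (B.history θ t ω.2))) atTop

/-- `h^j_b(p) = (σ_b² / p_b) / (σ_b² / p_b + σ_j² / p_j)`. -/
def selectionFunction (σ : Fin K → ℝ≥0) (b j : Fin K) (p : Fin K → ℝ) : ℝ :=
  ((σ b : ℝ) ^ 2 / p b) / ((σ b : ℝ) ^ 2 / p b + (σ j : ℝ) ^ 2 / p j)

/-- `p` is a component-wise strictly positive probability vector that satisfies information balance
and stationarity. -/
structure IsBalancedAllocation (θ : Fin K → ℝ) (σ : Fin K → ℝ≥0) (b : Fin K)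
    (p : Fin K → ℝ) : Prop where
  pos : ∀ i, 0 < p i
  sum_eq_one : ∑ i, p i = 1
  information_balance : ∀ i j, i ≠ b → j ≠ b →
    (θ b - θ i) ^ 2 / ((σ b : ℝ) ^ 2 / p b + (σ i : ℝ) ^ 2 / p i) =
      (θ b - θ j) ^ 2 / ((σ b : ℝ) ^ 2 / p b + (σ j : ℝ) ^ 2 / p j)
  stationarity : p b = ∑ j ∈ Finset.univ.filter (fun j => j ≠ b),
    selectionFunction σ b j p * (p j / (1 - selectionFunction σ b j p))

end RankingSelection

end

/-! Put `d j = (θ b - θ j)^2`. When the counts `N i` grow, the posterior probability that `j` beats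
`b` is a Gaussian tail with exponent about `d j / (2 * (σ b^2 / N b + σ j^2 / N j))`, and a union
bound makes the smallest of these exponents decisive. Optimality is thus a max-min problem over
allocations. At the balanced allocation all pairwise rates equal one constant `Γ`, so a rule
converging to it attains `Γ * t / 2` to leading order (`eventually_le_negLog`).

No rule does better (`eventually_negLog_le`). Each rate is concave and homogeneous of degree one in
the counts, so it lies below its tangent at `p`. Suitable positive multiples of these tangents add
up to the total sample count, by stationarity; hence some rate is at most `Γ * t`
(`exists_rate_le`). This applies to the counts at every single time, so the competing allocation
need not converge. If it neglects a system forever, its exponent stays bounded.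

Sample means are controlled under adaptive sampling by exponential martingales
(`ae_abs_noiseSum_le`). Everything is then pathwise, which is why the coupling is irrelevant.

For existence and uniqueness, information balance leaves one free parameter `u` in the ratios `p j /
p b`, and stationarity equates a strictly decreasing function of `u` to a constant. -/

namespace RankingSelection

/-! ### Nonnegative martingales built from predictable factors -/

section Martingale

variable {Ω : Type*} {m0 : MeasurableSpace Ω} {μ : Measure Ω} [IsProbabilityMeasure μ]

/-- The products of mean-one factors that are independent of the past, each of them used only on a
predictable event, form a martingale. -/
theorem martingale_of_predictable_factor (ℱ : Filtration ℕ m0) {D : ℕ → Set Ω}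
    (hD : ∀ t, MeasurableSet[ℱ t] (D t)) {ξ : ℕ → Ω → ℝ}
    (hξm : ∀ t, Measurable[ℱ (t + 1)] (ξ t)) (hξint : ∀ t, Integrable (ξ t) μ)
    (hξind : ∀ t, Indep (MeasurableSpace.comap (ξ t) inferInstance) (ℱ t) μ)
    (hξ1 : ∀ t, ∫ ω, ξ t ω ∂μ = 1) {M : ℕ → Ω → ℝ} (hM0 : M 0 = fun _ => 1)
    (hM : ∀ t, M (t + 1) = M t + (D t).indicator (M t) * (ξ t - 1)) :
    Martingale M ℱ μ := by
  have hmeas : ∀ t, Measurable[ℱ t] (M t) := by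
    intro t
    induction t with
    | zero => rw [hM0]; exact measurable_const
    | succ t ih =>
      have hle : ℱ t ≤ ℱ (t + 1) := ℱ.mono (Nat.le_succ t)
      have h1 : Measurable[ℱ (t + 1)] (M t) := ih.mono hle le_rfl
      rw [hM]
      exact h1.add ((h1.indicator (hle _ (hD t))).mul ((hξm t).sub measurable_const))
  have hind : ∀ t, IndepFun ((D t).indicator (M t)) (ξ t - 1) μ := by
    intro t
    rw [IndepFun_iff_Indep]
    refine (indep_of_indep_of_le_left (indep_of_indep_of_le_right (hξind t) ?_) ?_).symm
    · exact ((hmeas t).indicator (hD t)).comap_le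
    · have : Measurable[MeasurableSpace.comap (ξ t) inferInstance] (ξ t - 1) :=
        (comap_measurable (ξ t)).sub measurable_const
      exact this.comap_le
  have hξint' : ∀ t, Integrable (ξ t - 1) μ := fun t => (hξint t).sub (integrable_const 1)
  have hint : ∀ t, Integrable (M t) μ := by
    intro t
    induction t with
    | zero => rw [hM0]; exact integrable_const 1
    | succ t ih =>
      rw [hM]
      -- Independence makes the product integrable without any boundedness of the factors.
      exact ih.add ((hind t).integrable_mul (ih.indicator (ℱ.le t _ (hD t))) (hξint' t))
  refine martingale_of_condExp_sub_eq_zero_nat (fun t => (hmeas t).stronglyMeasurable) hint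
    fun t => ?_
  have hincr : M (t + 1) - M t = (D t).indicator (M t) * (ξ t - 1) := by rw [hM]; ring
  have hDM := (hint t).indicator (ℱ.le t _ (hD t))
  have hpull := condExp_mul_of_stronglyMeasurable_left (m := ℱ t) (μ := μ)
    ((hmeas t).indicator (hD t)).stronglyMeasurable
    ((hind t).integrable_mul hDM (hξint' t)) (hξint' t)
  have hξ0 : ∫ ω, (ξ t - 1) ω ∂μ = 0 := by
    simp only [Pi.sub_apply, Pi.one_apply]
    rw [integral_sub (hξint t) (integrable_const 1), hξ1]
    simp
  have hle : MeasurableSpace.comap (ξ t) inferInstance ≤ m0 :=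
    ((hξm t).mono (ℱ.le (t + 1)) le_rfl).comap_le
  have hcond := condExp_indep_eq (μ := μ) (f := ξ t - 1) hle (ℱ.le t)
    ((comap_measurable (ξ t)).sub measurable_const).stronglyMeasurable (hξind t)
  rw [hincr]
  filter_upwards [hpull, hcond] with ω h1 h2
  rw [h1, Pi.mul_apply, h2, hξ0, mul_zero, Pi.zero_apply]

/-- A nonnegative martingale is almost surely bounded. -/
theorem ae_bddAbove_of_nonneg_martingale {ℱ : Filtration ℕ m0} {M : ℕ → Ω → ℝ}
    (hM : Martingale M ℱ μ) (h0 : ∀ t ω, 0 ≤ M t ω) :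
    ∀ᵐ ω ∂μ, BddAbove (Set.range fun t => M t ω) := by
  -- By nonnegativity the `L¹` norm is the constant mean, so Doob's convergence theorem applies, and
  -- convergent sequences are bounded.
  have hbdd : ∀ t, eLpNorm (M t) 1 μ ≤ ((∫ ω, M 0 ω ∂μ).toNNReal : ℝ≥0∞) := by
    intro t
    have h1 : ∫ ω, M t ω ∂μ = ∫ ω, M 0 ω ∂μ := by
      have := hM.setIntegral_eq (Nat.zero_le t) (MeasurableSet.univ)
      simpa using this.symm
    rw [eLpNorm_one_eq_lintegral_enorm, ← h1]
    rw [← ENNReal.ofReal, ofReal_integral_eq_lintegral_ofReal (hM.integrable t)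
      (Eventually.of_forall (h0 t))]
    refine lintegral_mono fun ω => ?_
    rw [Real.enorm_eq_ofReal (h0 t ω)]
  filter_upwards [hM.submartingale.exists_ae_tendsto_of_bdd hbdd] with ω hω
  obtain ⟨c, hc⟩ := hω
  exact hc.bddAbove_range

end Martingale

/-! ### The filtration of an experiment and the independence of fresh noise -/

namespace AllocationRule

variable {K : ℕ} (A : AllocationRule K)

/-- The seed and the noises of the first `t` steps. -/
def pastData (t : ℕ) (ω : A.Sample) : A.Seed × (Finset.range t → Fin K → ℝ) :=
  (ω.1, fun ℓ => ω.2 ℓ)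

theorem measurable_pastData (t : ℕ) : Measurable (A.pastData t) := by
  unfold pastData
  fun_prop

/-- The information available before step `t`. -/
def filtration : Filtration ℕ (inferInstance : MeasurableSpace A.Sample) where
  seq t := MeasurableSpace.comap (A.pastData t) inferInstance
  mono' := by
    intro s t hst
    have : A.pastData s =
        (fun x : A.Seed × (Finset.range t → Fin K → ℝ) =>
          (x.1, fun ℓ : Finset.range s =>
            x.2 ⟨ℓ, Finset.range_subset_range.2 hst ℓ.2⟩)) ∘ A.pastData t := rfl
    have hg : Measurable (fun x : A.Seed × (Finset.range t → Fin K → ℝ) =>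
          (x.1, fun ℓ : Finset.range s =>
            x.2 ⟨ℓ, Finset.range_subset_range.2 hst ℓ.2⟩)) := by fun_prop
    change MeasurableSpace.comap (A.pastData s) _ ≤ MeasurableSpace.comap (A.pastData t) _
    rw [this, ← MeasurableSpace.comap_comp]
    exact MeasurableSpace.comap_mono hg.comap_le
  le' t := (A.measurable_pastData t).comap_le

theorem measurable_seed_filtration (t : ℕ) :
    Measurable[A.filtration t] (fun ω : A.Sample => ω.1) :=
  Measurable.comp (f := A.pastData t) (g := Prod.fst) measurable_fst
    (comap_measurable (A.pastData t))

theorem measurable_noise_filtration (t : ℕ) :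
    Measurable[A.filtration (t + 1)] (fun ω : A.Sample => ω.2 t) := by
  have hg : Measurable (fun x : A.Seed × (Finset.range (t + 1) → Fin K → ℝ) =>
      x.2 ⟨t, Finset.self_mem_range_succ t⟩) := by fun_prop
  exact hg.comp (comap_measurable (A.pastData (t + 1)))

/-- The system selected at step `t`. -/
def chosen (θ : Fin K → ℝ) (t : ℕ) (ω : A.Sample) : Fin K := A.select t ω.1 (A.history θ t ω)

/-- Taking measurability of the history as a hypothesis lets this serve inside the induction that
proves it. -/
theorem measurable_chosen_of_history (θ : Fin K → ℝ) (t : ℕ)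
    (h : Measurable[A.filtration t] (A.history θ t)) :
    Measurable[A.filtration t] (A.chosen θ t) :=
  (A.measurable_select t).comp ((A.measurable_seed_filtration t).prodMk h)

theorem measurable_history (θ : Fin K → ℝ) (t : ℕ) :
    Measurable[A.filtration t] (A.history θ t) := by
  induction t with
  | zero => exact measurable_const (a := (Fin.elim0 : History K 0))
  | succ t ih =>
    have hle : A.filtration t ≤ A.filtration (t + 1) := A.filtration.mono (Nat.le_succ t)
    have hc : Measurable[A.filtration (t + 1)] (A.chosen θ t) :=
      (A.measurable_chosen_of_history θ t ih).mono hle le_rfl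
    -- Reading the noise at a random index is jointly measurable because there are only countably
    -- many indices.
    have heval : Measurable fun x : Fin K × (Fin K → ℝ) => θ x.1 + x.2 x.1 :=
      measurable_from_prod_countable_right fun i => by fun_prop
    have hy : Measurable[A.filtration (t + 1)]
        fun ω : A.Sample => θ (A.chosen θ t ω) + ω.2 t (A.chosen θ t ω) :=
      heval.comp (hc.prodMk (A.measurable_noise_filtration t))
    refine (@measurable_pi_iff A.Sample (Fin (t + 1)) (fun _ => Fin K × ℝ)
      (A.filtration (t + 1)) _ _).2 fun ℓ => ?_
    refine Fin.lastCases ?_ (fun ℓ => ?_) ℓ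
    · simp only [history, Fin.snoc_last]
      exact hc.prodMk hy
    · simp only [history, Fin.snoc_castSucc]
      exact (measurable_pi_apply ℓ).comp (ih.mono hle le_rfl)

theorem measurable_chosen (θ : Fin K → ℝ) (t : ℕ) :
    Measurable[A.filtration t] (A.chosen θ t) :=
  A.measurable_chosen_of_history θ t (A.measurable_history θ t)

variable (σ : Fin K → ℝ≥0)

instance : IsProbabilityMeasure (A.law σ) := by
  unfold law
  infer_instance

theorem map_noise_law (t : ℕ) (i : Fin K) :
    (A.law σ).map (fun ω : A.Sample => ω.2 t i) = gaussianReal 0 (σ i ^ 2) := by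
  have h1 := (measurePreserving_snd (μ := A.seedLaw)
    (ν := Measure.infinitePi fun _ : ℕ => Measure.pi fun i : Fin K => gaussianReal 0 (σ i ^ 2)))
  have h2 := measurePreserving_eval_infinitePi
    (fun _ : ℕ => Measure.pi fun i : Fin K => gaussianReal 0 (σ i ^ 2)) t
  have h3 := measurePreserving_eval (fun i : Fin K => gaussianReal 0 (σ i ^ 2)) i
  exact ((h3.comp h2).comp h1).map_eq

/-- The noise of step `t` is independent of the information available before that step. -/
theorem indepFun_noise_pastData (t : ℕ) :
    IndepFun (fun ω : A.Sample => ω.2 t) (A.pastData t) (A.law σ) := by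
  set ν := Measure.infinitePi fun _ : ℕ => Measure.pi fun i : Fin K => gaussianReal 0 (σ i ^ 2)
    with hν
  have hind : IndepFun (fun (w : ℕ → Fin K → ℝ) (ℓ : Finset.range t) => w ℓ) (fun w => w t) ν := by
    have h := (iIndepFun_infinitePi
      (P := fun _ : ℕ => Measure.pi fun i : Fin K => gaussianReal 0 (σ i ^ 2))
      (X := fun _ x => x) (fun _ => measurable_id)).indepFun_finset (Finset.range t) {t}
      (by simp) (fun i => measurable_pi_apply i)
    exact h.comp (φ := id) (ψ := fun y : ({t} : Finset ℕ) → Fin K → ℝ =>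
      y ⟨t, Finset.mem_singleton_self t⟩) measurable_id (measurable_pi_apply _)
  have hmr : Measurable (fun (w : ℕ → Fin K → ℝ) (ℓ : Finset.range t) => w ℓ) := by fun_prop
  have hme : Measurable (fun w : ℕ → Fin K → ℝ => w t) := by fun_prop
  rw [indepFun_iff_map_prod_eq_prod_map_map hmr.aemeasurable hme.aemeasurable] at hind
  refine IndepFun.symm ?_
  rw [indepFun_iff_map_prod_eq_prod_map_map (A.measurable_pastData t).aemeasurable
    (by fun_prop)]
  have e1 : (A.law σ).map (A.pastData t) =
      A.seedLaw.prod (ν.map fun (w : ℕ → Fin K → ℝ) (ℓ : Finset.range t) => w ℓ) := by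
    have := Measure.map_prod_map A.seedLaw ν measurable_id hmr
    rw [Measure.map_id] at this
    exact this.symm
  have e2 : (A.law σ).map (fun ω : A.Sample => ω.2 t) = ν.map fun w => w t := by
    have h1 := measurePreserving_snd (μ := A.seedLaw) (ν := ν)
    have : (fun ω : A.Sample => ω.2 t) = (fun w : ℕ → Fin K → ℝ => w t) ∘ Prod.snd := rfl
    rw [this, ← Measure.map_map hme measurable_snd]
    exact congrArg _ h1.map_eq
  -- Reassociating seed × (past × present) as (seed × past) × present reduces the claim to
  -- independence within the noise array.
  have e3 : (A.law σ).map (fun ω => (A.pastData t ω, ω.2 t)) =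
      (A.seedLaw.prod (ν.map fun w => ((fun ℓ : Finset.range t => w ℓ), w t))).map
        MeasurableEquiv.prodAssoc.symm := by
    have := Measure.map_prod_map A.seedLaw ν measurable_id (hmr.prodMk hme)
    rw [Measure.map_id] at this
    rw [this, Measure.map_map (MeasurableEquiv.measurable _) (by fun_prop)]
    rfl
  have : IsProbabilityMeasure (ν.map fun (w : ℕ → Fin K → ℝ) (ℓ : Finset.range t) => w ℓ) :=
    Measure.isProbabilityMeasure_map hmr.aemeasurable
  have : IsProbabilityMeasure (ν.map fun w => w t) :=
    Measure.isProbabilityMeasure_map hme.aemeasurable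
  rw [e1, e2, e3, hind]
  exact ((measurePreserving_prodAssoc A.seedLaw _ _).symm MeasurableEquiv.prodAssoc).map_eq

end AllocationRule

end RankingSelection

/-! ### Accumulated noise and consistency of the sample means -/

namespace RankingSelection

variable {K : ℕ}

/-- The noise accumulated in the observations of system `i` whose mean is `m`. -/
def noiseSum (m : ℝ) {t : ℕ} (h : History K t) (i : Fin K) : ℝ :=
  (∑ ℓ, if (h ℓ).1 = i then (h ℓ).2 else 0) - m * sampleCount h i

theorem sampleCount_snoc {t : ℕ} (h : History K t) (x : Fin K × ℝ) (i : Fin K) :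
    sampleCount (Fin.snoc h x : History K (t + 1)) i =
      sampleCount h i + if x.1 = i then 1 else 0 := by
  simp only [sampleCount, Finset.card_filter, Fin.sum_univ_castSucc, Fin.snoc_castSucc,
    Fin.snoc_last]

theorem noiseSum_snoc (m : ℝ) {t : ℕ} (h : History K t) (x : Fin K × ℝ) (i : Fin K) :
    noiseSum m (Fin.snoc h x : History K (t + 1)) i =
      noiseSum m h i + if x.1 = i then x.2 - m else 0 := by
  simp only [noiseSum, sampleCount_snoc, Fin.sum_univ_castSucc, Fin.snoc_castSucc,
    Fin.snoc_last]
  split_ifs <;> push_cast <;> ring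

theorem sampleMean_sub_eq (m : ℝ) {t : ℕ} (h : History K t) (i : Fin K)
    (hi : sampleCount h i ≠ 0) : sampleMean h i - m = noiseSum m h i / sampleCount h i := by
  have : (sampleCount h i : ℝ) ≠ 0 := by exact_mod_cast hi
  unfold sampleMean noiseSum
  field_simp

theorem sampleMean_of_sampleCount_eq_zero {t : ℕ} {h : History K t} {i : Fin K}
    (hi : sampleCount h i = 0) : sampleMean h i = 0 := by
  simp [sampleMean, hi]

theorem sum_sampleCount {t : ℕ} (h : History K t) : ∑ i, sampleCount h i = t := by
  have := Finset.card_eq_sum_card_fiberwise (s := (Finset.univ : Finset (Fin t)))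
    (t := (Finset.univ : Finset (Fin K))) (f := fun ℓ => (h ℓ).1) (by simp)
  simpa [sampleCount] using this.symm

namespace AllocationRule

variable (A : AllocationRule K) (θ : Fin K → ℝ) (σ : Fin K → ℝ≥0)

theorem sampleCount_history_succ (t : ℕ) (ω : A.Sample) (i : Fin K) :
    sampleCount (A.history θ (t + 1) ω) i =
      sampleCount (A.history θ t ω) i + if A.chosen θ t ω = i then 1 else 0 := by
  rw [history, sampleCount_snoc]
  rfl

theorem noiseSum_history_succ (t : ℕ) (ω : A.Sample) (i : Fin K) :
    noiseSum (θ i) (A.history θ (t + 1) ω) i =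
      noiseSum (θ i) (A.history θ t ω) i + if A.chosen θ t ω = i then ω.2 t i else 0 := by
  rw [history, noiseSum_snoc]
  change _ + (if A.chosen θ t ω = i then _ else _) = _
  split_ifs with h
  · have : A.select t ω.1 (A.history θ t ω) = i := h
    simp only [this]
    ring
  · rfl

theorem monotone_sampleCount (ω : A.Sample) (i : Fin K) :
    Monotone fun t => sampleCount (A.history θ t ω) i :=
  monotone_nat_of_le_succ fun t => by
    rw [A.sampleCount_history_succ]
    exact Nat.le_add_right _ _

/-- The exponential martingale of the noise accumulated by system `i`. -/
noncomputable def expMartingale (i : Fin K) (c : ℝ) (t : ℕ) (ω : A.Sample) : ℝ :=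
  Real.exp (c * noiseSum (θ i) (A.history θ t ω) i -
    (σ i : ℝ) ^ 2 * c ^ 2 / 2 * sampleCount (A.history θ t ω) i)

/-- The selection of `i` at step `t` is decided before the noise of that step, and `exp (c * W)`
divided by its Gaussian mean is a mean-one factor independent of the past. -/
theorem martingale_expMartingale (i : Fin K) (c : ℝ) :
    Martingale (A.expMartingale θ σ i c) A.filtration (A.law σ) := by
  set v : ℝ := (σ i : ℝ) ^ 2 * c ^ 2 / 2 with hv
  have hmap := A.map_noise_law σ
  have hwm : ∀ t, Measurable fun ω : A.Sample => ω.2 t i := fun t => by fun_prop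
  have hint : ∀ t, Integrable (fun ω : A.Sample => Real.exp (c * ω.2 t i)) (A.law σ) := by
    intro t
    have h := integrable_exp_mul_gaussianReal (μ := 0) (v := σ i ^ 2) c
    rw [← hmap t i] at h
    exact h.comp_measurable (hwm t)
  have hmgf : ∀ t, ∫ ω : A.Sample, Real.exp (c * ω.2 t i) ∂(A.law σ) = Real.exp v := by
    intro t
    have h := mgf_gaussianReal (hmap t i) c
    rw [mgf] at h
    rw [h, hv]
    simp
  have hg : ∀ t, Measurable[A.filtration (t + 1)] fun ω : A.Sample => ω.2 t i := fun t =>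
    (measurable_pi_apply i).comp (A.measurable_noise_filtration t)
  refine martingale_of_predictable_factor A.filtration
    (D := fun t => {ω | A.chosen θ t ω = i})
    (ξ := fun t ω => Real.exp (c * ω.2 t i) * Real.exp (-v)) ?_ ?_ ?_ ?_ ?_ ?_ ?_
  · exact fun t => A.measurable_chosen θ t (measurableSet_singleton i)
  · intro t
    exact (Real.measurable_exp.comp ((hg t).const_mul c)).mul measurable_const
  · exact fun t => (hint t).mul_const _
  · intro t
    have h := (A.indepFun_noise_pastData σ t).comp
      (φ := fun w : Fin K → ℝ => Real.exp (c * w i) * Real.exp (-v)) (ψ := id)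
      (by fun_prop) measurable_id
    exact (IndepFun_iff_Indep _ _ _).1 h
  · intro t
    rw [integral_mul_const, hmgf, ← Real.exp_add, add_neg_cancel, Real.exp_zero]
  · funext ω
    simp [expMartingale, noiseSum, sampleCount]
  · intro t
    funext ω
    simp only [expMartingale, sampleCount_history_succ, noiseSum_history_succ, Pi.add_apply,
      Pi.mul_apply, Pi.sub_apply, Pi.one_apply, Set.indicator, Set.mem_ofPred_eq]
    split_ifs with h
    · rw [mul_sub, mul_one, add_sub_cancel, ← Real.exp_add, ← Real.exp_add]
      congr 1
      push_cast
      ring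
    · simp

/-- Almost sure boundedness of the exponential martingale bounds its exponent, through `x + 1 ≤ exp
x`. -/
theorem ae_noiseSum_le (i : Fin K) (c : ℝ) :
    ∀ᵐ ω ∂(A.law σ), ∃ C, ∀ t, c * noiseSum (θ i) (A.history θ t ω) i ≤
      C + (σ i : ℝ) ^ 2 * c ^ 2 / 2 * sampleCount (A.history θ t ω) i := by
  filter_upwards [ae_bddAbove_of_nonneg_martingale (A.martingale_expMartingale θ σ i c)
    fun t ω => (Real.exp_pos _).le] with ω ⟨C, hC⟩
  refine ⟨C, fun t => ?_⟩
  have h1 : A.expMartingale θ σ i c t ω ≤ C := hC ⟨t, rfl⟩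
  have h2 := Real.add_one_le_exp (c * noiseSum (θ i) (A.history θ t ω) i -
    (σ i : ℝ) ^ 2 * c ^ 2 / 2 * sampleCount (A.history θ t ω) i)
  rw [expMartingale] at h1
  linarith

/-- Almost surely the accumulated noise of every system grows sublinearly in its sample count. -/
theorem ae_abs_noiseSum_le (hσ : ∀ i, 0 < σ i) :
    ∀ᵐ ω ∂(A.law σ), ∀ i, ∀ ε : ℝ, 0 < ε → ∃ C, ∀ t,
      |noiseSum (θ i) (A.history θ t ω) i| ≤ C + ε * sampleCount (A.history θ t ω) i := by
  -- Only the countably many slopes `±1 / (n + 1)` are used, so one null set suffices. Dividing by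
  -- the slope `a` leaves the coefficient `σ i^2 * a / 2`, below any `ε` for large `n`.
  have key : ∀ᵐ ω ∂(A.law σ), ∀ i, ∀ n : ℕ,
      (∃ C, ∀ t, (1 / ((n : ℝ) + 1)) * noiseSum (θ i) (A.history θ t ω) i ≤
        C + (σ i : ℝ) ^ 2 * (1 / ((n : ℝ) + 1)) ^ 2 / 2 * sampleCount (A.history θ t ω) i) ∧
      (∃ C, ∀ t, (-(1 / ((n : ℝ) + 1))) * noiseSum (θ i) (A.history θ t ω) i ≤
        C + (σ i : ℝ) ^ 2 * (-(1 / ((n : ℝ) + 1))) ^ 2 / 2 *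
          sampleCount (A.history θ t ω) i) := by
    rw [ae_all_iff]; intro i
    rw [ae_all_iff]; intro n
    exact (A.ae_noiseSum_le θ σ i _).and (A.ae_noiseSum_le θ σ i _)
  filter_upwards [key] with ω hω i ε hε
  have hs : (0 : ℝ) < (σ i : ℝ) ^ 2 := by have := hσ i; positivity
  obtain ⟨n, hn⟩ := exists_nat_one_div_lt (show 0 < ε / (σ i : ℝ) ^ 2 by positivity)
  set a : ℝ := 1 / ((n : ℝ) + 1) with ha
  have ha0 : 0 < a := by positivity
  obtain ⟨⟨C₁, h₁⟩, ⟨C₂, h₂⟩⟩ := hω i n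
  refine ⟨max C₁ C₂ / a, fun t => ?_⟩
  specialize h₁ t
  specialize h₂ t
  set S := noiseSum (θ i) (A.history θ t ω) i
  have hN : (0 : ℝ) ≤ (sampleCount (A.history θ t ω) i : ℝ) := Nat.cast_nonneg _
  set N : ℝ := (sampleCount (A.history θ t ω) i : ℝ)
  rw [lt_div_iff₀ hs] at hn
  have h3 : (σ i : ℝ) ^ 2 * a ^ 2 / 2 * N ≤ a * (ε * N) := by
    have : (a * (σ i : ℝ) ^ 2) * (a * N) ≤ ε * (a * N) :=
      mul_le_mul_of_nonneg_right hn.le (by positivity)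
    have h0 : 0 ≤ (σ i : ℝ) ^ 2 * a ^ 2 * N := by positivity
    nlinarith
  have h4 : a * |S| ≤ max C₁ C₂ + a * (ε * N) := by
    rw [neg_sq] at h₂
    rcases abs_cases S with ⟨h, -⟩ | ⟨h, -⟩ <;> rw [h]
    · linarith [le_max_left C₁ C₂]
    · linarith [le_max_right C₁ C₂]
  have h5 : max C₁ C₂ = a * (max C₁ C₂ / a) := by field_simp
  rw [h5, ← mul_add] at h4
  exact le_of_mul_le_mul_left h4 ha0

end AllocationRule

/-- Sublinear noise makes the sample means of the systems that are sampled infinitely often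
converge. -/
theorem tendsto_sampleMean {h : (t : ℕ) → History K t} {i : Fin K} {m : ℝ}
    (hn : ∀ ε : ℝ, 0 < ε → ∃ C, ∀ t, |noiseSum m (h t) i| ≤ C + ε * sampleCount (h t) i)
    (hN : Tendsto (fun t => sampleCount (h t) i) atTop atTop) :
    Tendsto (fun t => sampleMean (h t) i) atTop (𝓝 m) := by
  rw [Metric.tendsto_atTop']
  intro ε hε
  obtain ⟨C, hC⟩ := hn (ε / 2) (by positivity)
  have hNr : Tendsto (fun t => (sampleCount (h t) i : ℝ)) atTop atTop :=
    tendsto_natCast_atTop_atTop.comp hN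
  have he := (hNr.eventually_gt_atTop (2 * C / ε)).and (hN.eventually_gt_atTop 0)
  obtain ⟨T, hT⟩ := he.exists_forall_of_atTop
  refine ⟨T, fun t ht => ?_⟩
  obtain ⟨h1, h2⟩ := hT t ht.le
  have hpos : (0 : ℝ) < sampleCount (h t) i := by exact_mod_cast h2
  rw [Real.dist_eq, sampleMean_sub_eq m _ _ h2.ne', abs_div, Nat.abs_cast, div_lt_iff₀ hpos]
  rw [div_lt_iff₀ hε] at h1
  linarith [hC t]

/-- Sublinear noise keeps the sample means bounded. -/
theorem exists_abs_sampleMean_le {h : (t : ℕ) → History K t} {i : Fin K} {m : ℝ}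
    (hn : ∀ ε : ℝ, 0 < ε → ∃ C, ∀ t, |noiseSum m (h t) i| ≤ C + ε * sampleCount (h t) i) :
    ∃ C, ∀ t, |sampleMean (h t) i| ≤ C := by
  obtain ⟨C, hC⟩ := hn 1 one_pos
  refine ⟨|m| + |C| + 1, fun t => ?_⟩
  by_cases h0 : sampleCount (h t) i = 0
  · rw [sampleMean_of_sampleCount_eq_zero h0, abs_zero]
    positivity
  · have hpos : (1 : ℝ) ≤ sampleCount (h t) i := by exact_mod_cast Nat.one_le_iff_ne_zero.2 h0
    have h1 : |sampleMean (h t) i - m| ≤ |C| + 1 := by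
      rw [sampleMean_sub_eq m _ _ h0, abs_div, Nat.abs_cast, div_le_iff₀ (by linarith)]
      have := hC t
      nlinarith [le_abs_self C, abs_nonneg C]
    have h2 := abs_sub_abs_le_abs_sub (sampleMean (h t) i) m
    linarith

end RankingSelection

/-! ### Gaussian tail bounds -/

/-- Chernoff bound for the upper tail of a Gaussian. -/
theorem gaussianReal_Ici_zero_le {m : ℝ} (hm : m ≤ 0) {v : ℝ≥0} (hv : v ≠ 0) :
    gaussianReal m v (Set.Ici 0) ≤ ENNReal.ofReal (Real.exp (-(m ^ 2 / (2 * v)))) := by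
  have hv0 : (0 : ℝ) < v := by exact_mod_cast pos_iff_ne_zero.2 hv
  -- `-m / v` minimizes the Chernoff exponent `m * t + v * t^2 / 2`; it is nonnegative since `m ≤
  -- 0`.
  have h := measure_ge_le_exp_mul_mgf (X := id) (μ := gaussianReal m v) (t := -m / v) 0
    (div_nonneg (by linarith) hv0.le) (integrable_exp_mul_gaussianReal _)
  rw [mgf_id_gaussianReal] at h
  simp only [mul_zero, Real.exp_zero, one_mul, id] at h
  rw [← ENNReal.ofReal_toReal (measure_ne_top (gaussianReal m v) (Set.Ici 0))]
  refine ENNReal.ofReal_le_ofReal (h.trans_eq ?_)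
  congr 1
  field_simp
  ring

/-- A lower bound for the upper tail of a Gaussian. -/
theorem le_gaussianReal_Ici_zero (m : ℝ) {v : ℝ≥0} (hv : v ≠ 0) :
    ENNReal.ofReal ((√(2 * Real.pi))⁻¹ * Real.exp (-((|m| / √v + 1) ^ 2 / 2))) ≤
      gaussianReal m v (Set.Ici 0) := by
  have hv0 : (0 : ℝ) < v := by exact_mod_cast pos_iff_ne_zero.2 hv
  have hs0 : 0 < √(v : ℝ) := Real.sqrt_pos.2 hv0
  have hsv : √(v : ℝ) ^ 2 = v := Real.sq_sqrt hv0.le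
  -- The density is integrated over an interval of length `√v` only, which cancels the `√v` in its
  -- normalization.
  have hc : ∀ x ∈ Set.Icc 0 √(v : ℝ),
      ENNReal.ofReal ((√(2 * Real.pi * v))⁻¹ * Real.exp (-((|m| / √v + 1) ^ 2 / 2))) ≤
        gaussianPDF m v x := by
    intro x hx
    rw [gaussianPDF_def, gaussianPDFReal_def]
    refine ENNReal.ofReal_le_ofReal (mul_le_mul_of_nonneg_left (Real.exp_le_exp.2 ?_)
      (by positivity))
    have h1 : |x - m| ≤ |m| + √v := by
      rw [abs_le]
      constructor <;> linarith [hx.1, hx.2, le_abs_self m, neg_abs_le m]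
    have h2 : (x - m) ^ 2 ≤ (|m| + √v) ^ 2 := sq_le_sq.2 (h1.trans (le_abs_self _))
    have h3 : (|m| / √v + 1) ^ 2 / 2 = (|m| + √v) ^ 2 / (2 * v) := by
      have : (|m| / √v + 1) ^ 2 / 2 = (|m| + √v) ^ 2 / (2 * √(v : ℝ) ^ 2) := by field_simp
      rw [this, hsv]
    rw [h3, neg_div, neg_le_neg_iff]
    gcongr
  calc ENNReal.ofReal ((√(2 * Real.pi))⁻¹ * Real.exp (-((|m| / √v + 1) ^ 2 / 2)))
      = ENNReal.ofReal ((√(2 * Real.pi * v))⁻¹ * Real.exp (-((|m| / √v + 1) ^ 2 / 2))) *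
          volume (Set.Icc 0 √(v : ℝ)) := by
        have hsq : √(2 * Real.pi * v) = √(2 * Real.pi) * √(v : ℝ) :=
          Real.sqrt_mul (by positivity) _
        have h2π : 0 < √(2 * Real.pi) := Real.sqrt_pos.2 (by positivity)
        rw [Real.volume_Icc, sub_zero, ← ENNReal.ofReal_mul (by positivity), hsq]
        congr 1
        rw [mul_inv]
        generalize √(2 * Real.pi) = a at h2π
        field_simp
    _ = ∫⁻ _ in Set.Icc 0 √(v : ℝ),
          ENNReal.ofReal ((√(2 * Real.pi * v))⁻¹ * Real.exp (-((|m| / √v + 1) ^ 2 / 2))) := by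
        rw [setLIntegral_const]
    _ ≤ ∫⁻ x in Set.Icc 0 √(v : ℝ), gaussianPDF m v x :=
        setLIntegral_mono' measurableSet_Icc hc
    _ ≤ ∫⁻ x in Set.Ici 0, gaussianPDF m v x :=
        lintegral_mono_set fun x hx => hx.1
    _ = gaussianReal m v (Set.Ici 0) := (gaussianReal_apply m hv _).symm

/-! ### Finite-sample bounds on the posterior probability of misidentification -/

namespace RankingSelection

variable {K : ℕ}

/-- The posterior variance of the mean of system `i`, the prior variance being `s`. -/
noncomputable def posteriorVariance (σ : Fin K → ℝ≥0) (s : ℝ≥0) {t : ℕ} (h : History K t)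
    (i : Fin K) : ℝ≥0 :=
  if sampleCount h i = 0 then s else σ i ^ 2 / (sampleCount h i : ℝ≥0)

/-- The two cases merge because the sample mean of an unsampled system is `0 / 0 = 0`, the prior
mean. -/
theorem posteriorMarginal_eq (σ : Fin K → ℝ≥0) (s : ℝ≥0) {t : ℕ} (h : History K t) (i : Fin K) :
    posteriorMarginal σ s h i = gaussianReal (sampleMean h i) (posteriorVariance σ s h i) := by
  unfold posteriorMarginal posteriorVariance
  split_ifs with h0
  · rw [sampleMean_of_sampleCount_eq_zero h0]
  · rfl

instance (σ : Fin K → ℝ≥0) (s : ℝ≥0) {t : ℕ} (h : History K t) (i : Fin K) :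
    IsProbabilityMeasure (posteriorMarginal σ s h i) := by
  rw [posteriorMarginal_eq]
  infer_instance

/-- Under the posterior `ϑ j - ϑ b` is a difference of independent Gaussians, so each pairwise error
is a one-dimensional tail. -/
theorem pi_posteriorMarginal_le_eq (σ : Fin K → ℝ≥0) (s : ℝ≥0) {t : ℕ} (h : History K t)
    {b j : Fin K} (hj : j ≠ b) :
    (Measure.pi fun i => posteriorMarginal σ s h i) {ϑ | ϑ b ≤ ϑ j} =
      gaussianReal (sampleMean h j - sampleMean h b)
        (posteriorVariance σ s h j + posteriorVariance σ s h b) (Set.Ici 0) := by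
  set P := Measure.pi fun i => posteriorMarginal σ s h i with hP
  have hind : IndepFun (fun ϑ : Fin K → ℝ => ϑ j) (fun ϑ => -ϑ b) P :=
    ((iIndepFun_pi (μ := fun i => posteriorMarginal σ s h i) (X := fun _ x => x)
      (fun _ => measurable_id.aemeasurable)).indepFun hj).comp
      (φ := id) (ψ := fun x => -x) measurable_id measurable_neg
  have hev : ∀ i, P.map (fun ϑ : Fin K → ℝ => ϑ i) =
      gaussianReal (sampleMean h i) (posteriorVariance σ s h i) := fun i => by
    rw [← posteriorMarginal_eq]
    exact (measurePreserving_eval (fun i => posteriorMarginal σ s h i) i).map_eq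
  have hneg : P.map (fun ϑ : Fin K → ℝ => -ϑ b) =
      gaussianReal (-sampleMean h b) (posteriorVariance σ s h b) := by
    rw [← gaussianReal_map_neg, ← hev b, Measure.map_map measurable_neg (by fun_prop)]
    rfl
  have hsum := gaussianReal_add_gaussianReal_of_indepFun hind (hev j) hneg
  rw [sub_eq_add_neg, ← hsum, Measure.map_apply (by fun_prop) measurableSet_Ici]
  congr 1
  ext ϑ
  simp [← sub_eq_add_neg]

theorem negLog_le_of_le {q : ℝ≥0∞} {x : ℝ} (h : ENNReal.ofReal (Real.exp (-x)) ≤ q) :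
    negLog q ≤ ENNReal.ofReal x := by
  have h1 := ENNReal.log_monotone h
  rw [ENNReal.log_ofReal_of_pos (Real.exp_pos _), Real.log_exp] at h1
  refine (EReal.toENNReal_le_toENNReal (EReal.neg_le_neg_iff.2 h1)).trans_eq ?_
  rw [EReal.coe_neg, neg_neg, EReal.toENNReal_of_ne_top (EReal.coe_ne_top x), EReal.toReal_coe]

theorem le_negLog_of_le {q : ℝ≥0∞} {x : ℝ} (h : q ≤ ENNReal.ofReal (Real.exp (-x))) :
    ENNReal.ofReal x ≤ negLog q := by
  have h1 := ENNReal.log_monotone h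
  rw [ENNReal.log_ofReal_of_pos (Real.exp_pos _), Real.log_exp] at h1
  refine le_trans (le_of_eq ?_) (EReal.toENNReal_le_toENNReal (EReal.neg_le_neg_iff.2 h1))
  rw [EReal.coe_neg, neg_neg, EReal.toENNReal_of_ne_top (EReal.coe_ne_top x), EReal.toReal_coe]

/-- If the standardized difference of the posterior means of `b` and of some other system is at
most `R`, then the posterior does not rule out that `b` is not the best. -/
theorem negLog_posteriorMisidentification_le (σ : Fin K → ℝ≥0) {t : ℕ} (h : History K t)
    {b j : Fin K} (hj : j ≠ b) {R : ℝ}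
    (hR : ∀ᶠ s : ℝ≥0 in atTop, 0 < posteriorVariance σ s h j + posteriorVariance σ s h b ∧
      |sampleMean h j - sampleMean h b| /
        √((posteriorVariance σ s h j + posteriorVariance σ s h b : ℝ≥0) : ℝ) ≤ R) :
    negLog (posteriorMisidentification σ b h) ≤
      ENNReal.ofReal ((R + 1) ^ 2 / 2 + Real.log √(2 * Real.pi)) := by
  refine negLog_le_of_le (le_liminf_of_le (by isBoundedDefault) ?_)
  filter_upwards [hR] with s ⟨hs, hsR⟩
  calc ENNReal.ofReal (Real.exp (-((R + 1) ^ 2 / 2 + Real.log √(2 * Real.pi))))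
      ≤ _ := ?_
    _ ≤ _ := le_gaussianReal_Ici_zero _ hs.ne'
    _ = _ := (pi_posteriorMarginal_le_eq σ s h hj).symm
    _ ≤ (Measure.pi fun i => posteriorMarginal σ s h i) (bestRegion b)ᶜ :=
        measure_mono fun ϑ (hϑ : ϑ b ≤ ϑ j) (hmem : ϑ ∈ bestRegion b) => (hmem j hj).not_ge hϑ
  refine ENNReal.ofReal_le_ofReal ?_
  have hpos : 0 < √(2 * Real.pi) := Real.sqrt_pos.2 (by positivity)
  rw [neg_add, Real.exp_add, Real.exp_neg (Real.log _), Real.exp_log hpos, mul_comm]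
  refine mul_le_mul_of_nonneg_left (Real.exp_le_exp.2 ?_) (by positivity)
  gcongr

/-- If all the standardized differences of the posterior means are large, then the posterior
concentrates on `b` being the best. -/
theorem le_negLog_posteriorMisidentification (σ : Fin K → ℝ≥0) (hσ : ∀ i, 0 < σ i) {t : ℕ}
    (h : History K t) (hN : ∀ i, sampleCount h i ≠ 0) {b : Fin K} {x : ℝ}
    (hmean : ∀ j, j ≠ b → sampleMean h j ≤ sampleMean h b)
    (hx : ∀ j, j ≠ b → x ≤ (sampleMean h j - sampleMean h b) ^ 2 /
      (2 * ((σ j : ℝ) ^ 2 / sampleCount h j + (σ b : ℝ) ^ 2 / sampleCount h b))) :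
    ENNReal.ofReal (x - Real.log K) ≤ negLog (posteriorMisidentification σ b h) := by
  have hK : 0 < (K : ℝ) := by exact_mod_cast b.pos
  have hvar : ∀ s i, posteriorVariance σ s h i = σ i ^ 2 / (sampleCount h i : ℝ≥0) :=
    fun s i => if_neg (hN i)
  refine le_negLog_of_le ?_
  refine liminf_le_of_le (by isBoundedDefault) fun q hq => ?_
  obtain ⟨s, hs⟩ := hq.exists
  refine hs.trans ?_
  have hsub : (bestRegion b)ᶜ ⊆
      ⋃ j ∈ Finset.univ.filter (fun j => j ≠ b), {ϑ : Fin K → ℝ | ϑ b ≤ ϑ j} := by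
    intro ϑ hϑ
    simp only [bestRegion, Set.mem_compl_iff, Set.mem_ofPred_eq, not_forall, not_lt] at hϑ
    obtain ⟨j, hj, hle⟩ := hϑ
    simp only [Set.mem_iUnion, Finset.mem_filter, Finset.mem_univ, true_and, Set.mem_ofPred_eq]
    exact ⟨j, hj, hle⟩
  -- The union bound over fewer than `K` competitors is the source of the loss `Real.log K`.
  calc (Measure.pi fun i => posteriorMarginal σ s h i) (bestRegion b)ᶜ
      ≤ ∑ j ∈ Finset.univ.filter (fun j => j ≠ b),
          (Measure.pi fun i => posteriorMarginal σ s h i) {ϑ : Fin K → ℝ | ϑ b ≤ ϑ j} :=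
        (measure_mono hsub).trans (measure_biUnion_finset_le _ _)
    _ ≤ ∑ _j ∈ Finset.univ.filter (fun j : Fin K => j ≠ b),
          ENNReal.ofReal (Real.exp (-x)) := by
        refine Finset.sum_le_sum fun j hj => ?_
        have hj' : j ≠ b := (Finset.mem_filter.1 hj).2
        rw [pi_posteriorMarginal_le_eq σ s h hj']
        have hv : posteriorVariance σ s h j + posteriorVariance σ s h b ≠ 0 := by
          rw [hvar, hvar]
          have h1 := hσ j
          have h2 : (0 : ℝ≥0) < sampleCount h j := by exact_mod_cast Nat.pos_of_ne_zero (hN j)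
          positivity
        refine (gaussianReal_Ici_zero_le (by linarith [hmean j hj']) hv).trans
          (ENNReal.ofReal_le_ofReal (Real.exp_le_exp.2 (neg_le_neg ?_)))
        have := hx j hj'
        rw [hvar, hvar]
        push_cast
        exact this
    _ ≤ ∑ _j : Fin K, ENNReal.ofReal (Real.exp (-x)) :=
        Finset.sum_le_sum_of_subset (Finset.filter_subset _ _)
    _ = ENNReal.ofReal (Real.exp (-(x - Real.log K))) := by
        rw [neg_sub, sub_eq_add_neg, Real.exp_add, Real.exp_log hK, Finset.sum_const,
          Finset.card_univ, Fintype.card_fin, nsmul_eq_mul, ENNReal.ofReal_mul hK.le,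
          ENNReal.ofReal_natCast]

end RankingSelection

/-! ### Existence, uniqueness and max-min optimality of the balanced allocation -/

namespace RankingSelection

variable {K : ℕ}

/-- The equation that determines the balanced allocation up to scaling. -/
theorem exists_scale_parameter {ι : Type*} {S : Finset ι} (hS : S.Nonempty) {d s : ι → ℝ}
    (hd : ∀ j ∈ S, 0 < d j) (hs : ∀ j ∈ S, 0 < s j) {a : ℝ} (ha : 0 < a) :
    ∃ u : ℝ, (∀ j ∈ S, a < d j * u) ∧ ∑ j ∈ S, s j / (d j * u - a) ^ 2 = 1 / a := by
  -- The smallest `d k` has the rightmost pole `a / d k`; beyond it all the denominators are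
  -- positive.
  obtain ⟨k, hk, hmin⟩ := S.exists_min_image d hS
  have hdk := hd k hk
  have hpos : ∀ u, a / d k < u → ∀ j ∈ S, a < d j * u := by
    intro u hu j hj
    rw [div_lt_iff₀ hdk] at hu
    have hu0 : 0 < u := by
      by_contra hneg
      nlinarith
    nlinarith [hmin j hj]
  set f : ℝ → ℝ := fun u => ∑ j ∈ S, s j / (d j * u - a) ^ 2 with hf
  set C : ℝ := ∑ j ∈ S, s j with hC
  have hCpos : 0 < C := Finset.sum_pos hs hS
  have hsk : 0 < s k := hs k hk
  -- close to the pole the sum is large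
  set δ : ℝ := √(s k * a) with hδ
  have hδ0 : 0 < δ := Real.sqrt_pos.2 (by positivity)
  have hδ2 : δ ^ 2 = s k * a := Real.sq_sqrt (by positivity)
  -- At distance `d k * u - a = Δ` every denominator is at least `Δ^2 = C * a`, so the sum is at
  -- most `1 / a`.
  set Δ : ℝ := √(C * a) with hΔ
  have hΔ2 : Δ ^ 2 = C * a := Real.sq_sqrt (by positivity)
  have hΔ0 : 0 < Δ := Real.sqrt_pos.2 (by positivity)
  have hδΔ : δ ≤ Δ := by
    refine Real.sqrt_le_sqrt (mul_le_mul_of_nonneg_right ?_ ha.le)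
    exact Finset.single_le_sum (fun j hj => (hs j hj).le) hk
  have hlo : 1 / a ≤ f ((a + δ) / d k) := by
    have h1 : s k / (d k * ((a + δ) / d k) - a) ^ 2 ≤ f ((a + δ) / d k) :=
      Finset.single_le_sum (f := fun j => s j / (d j * ((a + δ) / d k) - a) ^ 2)
        (fun j hj => div_nonneg (hs j hj).le (sq_nonneg _)) hk
    refine le_trans (le_of_eq ?_) h1
    rw [mul_div_cancel₀ _ hdk.ne', add_sub_cancel_left, hδ2]
    field_simp
  have hhi : f ((a + Δ) / d k) ≤ 1 / a := by
    calc f ((a + Δ) / d k) ≤ ∑ j ∈ S, s j / Δ ^ 2 := by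
          refine Finset.sum_le_sum fun j hj => ?_
          have : Δ ≤ d j * ((a + Δ) / d k) - a := by
            have h2 : d k * ((a + Δ) / d k) ≤ d j * ((a + Δ) / d k) :=
              mul_le_mul_of_nonneg_right (hmin j hj) (by positivity)
            rw [mul_div_cancel₀ _ hdk.ne'] at h2
            linarith
          have hsj := hs j hj
          gcongr
      _ = 1 / a := by
          rw [← Finset.sum_div, hΔ2, ← hC]
          field_simp
  have hcont : ContinuousOn f (Set.Icc ((a + δ) / d k) ((a + Δ) / d k)) := by
    refine continuousOn_finsetSum _ fun j hj => ?_
    refine ContinuousOn.div continuousOn_const (by fun_prop) fun u hu => ?_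
    have h1 : a / d k < u := lt_of_lt_of_le (by gcongr; linarith) hu.1
    have := hpos u h1 j hj
    exact pow_ne_zero 2 (by linarith)
  obtain ⟨u, hu, hfu⟩ := intermediate_value_Icc' (by gcongr) hcont ⟨hhi, hlo⟩
  exact ⟨u, hpos u (lt_of_lt_of_le (by gcongr; linarith) hu.1), hfu⟩

/-- Each summand is strictly decreasing to the right of its pole. -/
theorem scale_parameter_unique {ι : Type*} {S : Finset ι} (hS : S.Nonempty) {d s : ι → ℝ}
    (hd : ∀ j ∈ S, 0 < d j) (hs : ∀ j ∈ S, 0 < s j) {a u v : ℝ}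
    (hu : ∀ j ∈ S, a < d j * u) (hv : ∀ j ∈ S, a < d j * v)
    (h : ∑ j ∈ S, s j / (d j * u - a) ^ 2 = ∑ j ∈ S, s j / (d j * v - a) ^ 2) : u = v := by
  have key : ∀ x y : ℝ, (∀ j ∈ S, a < d j * x) → x < y →
      ∑ j ∈ S, s j / (d j * y - a) ^ 2 < ∑ j ∈ S, s j / (d j * x - a) ^ 2 := by
    intro x y hx hxy
    refine Finset.sum_lt_sum_of_nonempty hS fun j hj => ?_
    have h1 := hx j hj
    have h2 := mul_lt_mul_of_pos_left hxy (hd j hj)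
    have h3 := hs j hj
    have h4 : 0 < d j * x - a := by linarith
    have h5 : d j * x - a < d j * y - a := by linarith
    gcongr
  rcases lt_trichotomy u v with hlt | heq | hlt
  · exact absurd h (key u v hu hlt).ne'
  · exact heq
  · exact absurd h (key v u hv hlt).ne

/-- The stationarity summand in closed form. -/
theorem selectionFunction_mul_div {σ : Fin K → ℝ≥0} (hσ : ∀ i, 0 < σ i) {p : Fin K → ℝ}
    (hp : ∀ i, 0 < p i) (b j : Fin K) :
    selectionFunction σ b j p * (p j / (1 - selectionFunction σ b j p)) =
      (σ b : ℝ) ^ 2 * p j ^ 2 / ((σ j : ℝ) ^ 2 * p b) := by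
  have h1 : (0 : ℝ) < σ b := hσ b
  have h2 : (0 : ℝ) < σ j := hσ j
  have h3 := hp b
  have h4 := hp j
  have hsum : 0 < (σ b : ℝ) ^ 2 / p b + (σ j : ℝ) ^ 2 / p j := by positivity
  have h5 : 1 - selectionFunction σ b j p =
      ((σ j : ℝ) ^ 2 / p j) / ((σ b : ℝ) ^ 2 / p b + (σ j : ℝ) ^ 2 / p j) := by
    unfold selectionFunction
    rw [eq_div_iff hsum.ne', sub_mul, div_mul_cancel₀ _ hsum.ne']
    ring
  rw [h5, selectionFunction]
  field_simp

/-- The second form involves only the ratios `p j / p b`, so it is insensitive to normalization. -/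
theorem stationarity_iff {σ : Fin K → ℝ≥0} (hσ : ∀ i, 0 < σ i) {p : Fin K → ℝ}
    (hp : ∀ i, 0 < p i) (b : Fin K) :
    p b = ∑ j ∈ Finset.univ.filter (fun j => j ≠ b),
      selectionFunction σ b j p * (p j / (1 - selectionFunction σ b j p)) ↔
    ∑ j ∈ Finset.univ.filter (fun j => j ≠ b), p j ^ 2 / (p b ^ 2 * (σ j : ℝ) ^ 2) =
      1 / (σ b : ℝ) ^ 2 := by
  have h1 : (0 : ℝ) < σ b := hσ b
  have h3 := hp b
  have h : ∀ j, (σ b : ℝ) ^ 2 * p j ^ 2 / ((σ j : ℝ) ^ 2 * p b) =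
      ((σ b : ℝ) ^ 2 * p b) * (p j ^ 2 / (p b ^ 2 * (σ j : ℝ) ^ 2)) := by
    intro j
    have h2 : (0 : ℝ) < σ j := hσ j
    field_simp
  simp_rw [selectionFunction_mul_div hσ hp, h, ← Finset.mul_sum]
  rw [eq_div_iff (by positivity)]
  constructor
  · intro e
    have : p b * 1 = p b * ((∑ j ∈ Finset.univ.filter (fun j => j ≠ b),
        p j ^ 2 / (p b ^ 2 * (σ j : ℝ) ^ 2)) * (σ b : ℝ) ^ 2) := by linarith
    exact (mul_left_cancel₀ h3.ne' this).symm
  · intro e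
    linear_combination (- p b) * e

/-- With the weight of `b` set to `1`, the weights `σ j^2 / (d j * u - σ b^2)`, where `d j = (θ b -
θ j)^2`, give information balance for every admissible `u`; stationarity selects `u`. -/
theorem exists_isBalancedAllocation (hK : 2 ≤ K) (θ : Fin K → ℝ) (σ : Fin K → ℝ≥0)
    (hσ : ∀ i, 0 < σ i) (b : Fin K) (hb : ∀ j, j ≠ b → θ j < θ b) :
    ∃ p : Fin K → ℝ, IsBalancedAllocation θ σ b p := by
  set S := Finset.univ.filter (fun j : Fin K => j ≠ b) with hSdef
  have hmem : ∀ j, j ∈ S ↔ j ≠ b := by simp [hSdef]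
  have hS : S.Nonempty := by
    have : Nontrivial (Fin K) := Fin.nontrivial_iff_two_le.2 hK
    obtain ⟨j, hj⟩ := exists_ne b
    exact ⟨j, (hmem j).2 hj⟩
  have hσ2 : ∀ i, 0 < (σ i : ℝ) ^ 2 := fun i => by have := hσ i; positivity
  have hd : ∀ j ∈ S, 0 < (θ b - θ j) ^ 2 := fun j hj => by
    have := hb j ((hmem j).1 hj)
    exact pow_pos (by linarith) 2
  obtain ⟨u, hu, hsum⟩ := exists_scale_parameter hS hd (s := fun j => (σ j : ℝ) ^ 2)
    (fun j _ => hσ2 j) (hσ2 b)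
  set x : Fin K → ℝ := fun j =>
    if j = b then 1 else (σ j : ℝ) ^ 2 / ((θ b - θ j) ^ 2 * u - (σ b : ℝ) ^ 2) with hx
  have hxb : x b = 1 := by simp [hx]
  have hxj : ∀ j, j ≠ b → x j = (σ j : ℝ) ^ 2 / ((θ b - θ j) ^ 2 * u - (σ b : ℝ) ^ 2) :=
    fun j hj => by simp [hx, hj]
  have hgap : ∀ j, j ≠ b → 0 < (θ b - θ j) ^ 2 * u - (σ b : ℝ) ^ 2 := fun j hj => by
    have := hu j ((hmem j).2 hj)
    linarith
  have hxpos : ∀ j, 0 < x j := by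
    intro j
    by_cases hj : j = b
    · rw [hj, hxb]; exact one_pos
    · rw [hxj j hj]; exact div_pos (hσ2 j) (hgap j hj)
  set X := ∑ i, x i with hX
  have hXpos : 0 < X := Finset.sum_pos (fun i _ => hxpos i) ⟨b, Finset.mem_univ b⟩
  have hp : ∀ i, 0 < x i / X := fun i => div_pos (hxpos i) hXpos
  have hbal : ∀ i, i ≠ b → (θ b - θ i) ^ 2 /
      ((σ b : ℝ) ^ 2 / (x b / X) + (σ i : ℝ) ^ 2 / (x i / X)) = 1 / (X * u) := by
    intro i hi
    have h1 := hgap i hi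
    have h2 := hσ2 i
    have h3 := hd i ((hmem i).2 hi)
    have hu0 : 0 < u := by
      by_contra hneg
      have := hσ2 b
      nlinarith
    have hσi : (σ i : ℝ) ≠ 0 := by exact_mod_cast (hσ i).ne'
    have hθi : θ b - θ i ≠ 0 := sub_ne_zero.2 (hb i hi).ne'
    have h4 : (σ b : ℝ) ^ 2 / (x b / X) + (σ i : ℝ) ^ 2 / (x i / X) =
        X * ((θ b - θ i) ^ 2 * u) := by
      rw [hxb, hxj i hi]
      field_simp
      ring
    rw [h4]
    field_simp
  refine ⟨fun i => x i / X, hp, ?_, fun i j hi hj => ?_, ?_⟩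
  · rw [← Finset.sum_div, div_self hXpos.ne']
  · rw [hbal i hi, hbal j hj]
  · refine (stationarity_iff hσ hp b).2 ?_
    rw [← hsum]
    refine Finset.sum_congr rfl fun j hj => ?_
    have hj' := (hmem j).1 hj
    have h1 := hgap j hj'
    have h2 := hσ2 j
    simp only [hxb, hxj j hj']
    field_simp

namespace IsBalancedAllocation

variable {θ : Fin K → ℝ} {σ : Fin K → ℝ≥0} {b : Fin K} {p : Fin K → ℝ}

/-- The ratios `p_j / p_b` of a balanced allocation in terms of a single parameter. -/
theorem exists_scale (hK : 2 ≤ K) (hσ : ∀ i, 0 < σ i) (hb : ∀ j, j ≠ b → θ j < θ b)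
    (hp : IsBalancedAllocation θ σ b p) :
    ∃ u : ℝ, ∀ j, j ≠ b → (σ b : ℝ) ^ 2 < (θ b - θ j) ^ 2 * u ∧
      p j / p b = (σ j : ℝ) ^ 2 / ((θ b - θ j) ^ 2 * u - (σ b : ℝ) ^ 2) := by
  have : Nontrivial (Fin K) := Fin.nontrivial_iff_two_le.2 hK
  obtain ⟨k, hk⟩ := exists_ne b
  have hσ2 : ∀ i, 0 < (σ i : ℝ) ^ 2 := fun i => by have := hσ i; positivity
  have hpb := hp.pos b
  have hd : ∀ j, j ≠ b → 0 < (θ b - θ j) ^ 2 := fun j hj => by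
    have := hb j hj
    exact pow_pos (by linarith) 2
  set c := (θ b - θ k) ^ 2 / ((σ b : ℝ) ^ 2 / p b + (σ k : ℝ) ^ 2 / p k) with hc
  -- Balance reads `(θ b - θ j)^2 / c = σ b^2 / p b + σ j^2 / p j`; multiplying by `p b` isolates
  -- the ratio.
  refine ⟨p b / c, fun j hj => ?_⟩
  have hpj := hp.pos j
  have hs := hσ2 b
  have hsj := hσ2 j
  have hdj := hd j hj
  have hσj : (σ j : ℝ) ≠ 0 := by exact_mod_cast (hσ j).ne'
  have hθj : θ b - θ j ≠ 0 := sub_ne_zero.2 (hb j hj).ne'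
  have hcj : c = (θ b - θ j) ^ 2 / ((σ b : ℝ) ^ 2 / p b + (σ j : ℝ) ^ 2 / p j) :=
    hp.information_balance k j hk hj
  have hE : (θ b - θ j) ^ 2 * (p b / c) - (σ b : ℝ) ^ 2 = (σ j : ℝ) ^ 2 * p b / p j := by
    rw [hcj]
    field_simp
    ring
  constructor
  · have : 0 < (σ j : ℝ) ^ 2 * p b / p j := by positivity
    linarith
  · rw [hE]
    field_simp

/-- Both allocations solve the same monotone equation for the parameter, hence share all ratios, and
the total mass one fixes the scale. -/
theorem unique (hK : 2 ≤ K) (hσ : ∀ i, 0 < σ i) (hb : ∀ j, j ≠ b → θ j < θ b)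
    (hp : IsBalancedAllocation θ σ b p) {q : Fin K → ℝ} (hq : IsBalancedAllocation θ σ b q) :
    p = q := by
  have hnt : Nontrivial (Fin K) := Fin.nontrivial_iff_two_le.2 hK
  set S := Finset.univ.filter (fun j : Fin K => j ≠ b) with hSdef
  have hmem : ∀ j, j ∈ S ↔ j ≠ b := by simp [hSdef]
  have hS : S.Nonempty := by
    obtain ⟨j, hj⟩ := exists_ne b
    exact ⟨j, (hmem j).2 hj⟩
  have hσ2 : ∀ i, 0 < (σ i : ℝ) ^ 2 := fun i => by have := hσ i; positivity
  have hd : ∀ j ∈ S, 0 < (θ b - θ j) ^ 2 := fun j hj => by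
    have := hb j ((hmem j).1 hj)
    exact pow_pos (by linarith) 2
  have key : ∀ r : Fin K → ℝ, IsBalancedAllocation θ σ b r → ∀ u : ℝ,
      (∀ j, j ≠ b → (σ b : ℝ) ^ 2 < (θ b - θ j) ^ 2 * u ∧
        r j / r b = (σ j : ℝ) ^ 2 / ((θ b - θ j) ^ 2 * u - (σ b : ℝ) ^ 2)) →
      ∑ j ∈ S, (σ j : ℝ) ^ 2 / ((θ b - θ j) ^ 2 * u - (σ b : ℝ) ^ 2) ^ 2 =
        1 / (σ b : ℝ) ^ 2 := by
    intro r hr u hu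
    rw [← (stationarity_iff hσ hr.pos b).1 hr.stationarity]
    refine Finset.sum_congr rfl fun j hj => ?_
    have hj' := (hmem j).1 hj
    obtain ⟨h1, h2⟩ := hu j hj'
    have h3 : 0 < (θ b - θ j) ^ 2 * u - (σ b : ℝ) ^ 2 := by linarith
    have h4 := hσ2 j
    have hσj : (σ j : ℝ) ≠ 0 := by exact_mod_cast (hσ j).ne'
    rw [← div_div (r j ^ 2), ← div_pow (r j), h2]
    field_simp
  obtain ⟨u, hu⟩ := hp.exists_scale hK hσ hb
  obtain ⟨v, hv⟩ := hq.exists_scale hK hσ hb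
  have huv : u = v := scale_parameter_unique hS hd (s := fun j => (σ j : ℝ) ^ 2) (fun j _ => hσ2 j)
    (fun j hj => (hu j ((hmem j).1 hj)).1) (fun j hj => (hv j ((hmem j).1 hj)).1)
    ((key p hp u hu).trans (key q hq v hv).symm)
  have hratio : ∀ j, p j / p b = q j / q b := by
    intro j
    by_cases hj : j = b
    · rw [hj, div_self (hp.pos b).ne', div_self (hq.pos b).ne']
    · rw [(hu j hj).2, (hv j hj).2, huv]
  have hinv : 1 / p b = 1 / q b := by
    rw [← hp.sum_eq_one, Finset.sum_div, Finset.sum_congr rfl fun j _ => hratio j,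
      ← Finset.sum_div, hq.sum_eq_one, hp.sum_eq_one]
  have hbq : p b = q b := by
    have h1 := hp.pos b
    have h2 := hq.pos b
    field_simp at hinv
    linarith
  funext j
  have h := hratio j
  rw [hbq] at h
  exact (div_left_inj' (hq.pos b).ne').1 h

/-- No allocation of the samples makes all the pairwise rates exceed those of the balanced
allocation. -/
theorem exists_rate_le (hK : 2 ≤ K) (hσ : ∀ i, 0 < σ i) (hb : ∀ j, j ≠ b → θ j < θ b)
    (hp : IsBalancedAllocation θ σ b p) {Γ : ℝ}
    (hΓ : ∀ j, j ≠ b → (θ b - θ j) ^ 2 / ((σ b : ℝ) ^ 2 / p b + (σ j : ℝ) ^ 2 / p j) = Γ)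
    {q : Fin K → ℝ} (hq : ∀ i, 0 < q i) :
    ∃ j, j ≠ b ∧ (θ b - θ j) ^ 2 / ((σ b : ℝ) ^ 2 / q b + (σ j : ℝ) ^ 2 / q j) ≤
      Γ * ∑ i, q i := by
  have hnt : Nontrivial (Fin K) := Fin.nontrivial_iff_two_le.2 hK
  set S := Finset.univ.filter (fun j : Fin K => j ≠ b) with hSdef
  have hmem : ∀ j, j ∈ S ↔ j ≠ b := by simp [hSdef]
  have hσ2 : ∀ i, 0 < (σ i : ℝ) ^ 2 := fun i => by have := hσ i; positivity
  have hd : ∀ j, j ≠ b → 0 < (θ b - θ j) ^ 2 := fun j hj => by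
    have := hb j hj
    exact pow_pos (by linarith) 2
  -- the weights `w j` are the multipliers of the max-min problem
  set w : Fin K → ℝ := fun j => (σ j : ℝ) ^ 2 *
    ((σ b : ℝ) ^ 2 / p b + (σ j : ℝ) ^ 2 / p j) ^ 2 /
      ((θ b - θ j) ^ 2 * ((σ j : ℝ) ^ 2 / p j) ^ 2) with hw
  have hwpos : ∀ j, j ≠ b → 0 < w j := by
    intro j hj
    have h1 := hσ2 j
    have h2 := hσ2 b
    have h3 := hd j hj
    have h4 := hp.pos j
    have h5 := hp.pos b
    simp only [hw]
    positivity
  have hstat := (stationarity_iff hσ hp.pos b).1 hp.stationarity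
  have hstat' : ∑ j ∈ S, (σ b : ℝ) ^ 2 * (p j ^ 2 / (p b ^ 2 * (σ j : ℝ) ^ 2)) = 1 := by
    rw [← Finset.mul_sum, hstat, mul_one_div_cancel (hσ2 b).ne']
  have hsplit : ∀ r : Fin K → ℝ, ∑ j ∈ S,
      ((σ b : ℝ) ^ 2 * (p j ^ 2 / (p b ^ 2 * (σ j : ℝ) ^ 2)) * r b + r j) = ∑ i, r i := by
    intro r
    rw [Finset.sum_add_distrib, ← Finset.sum_mul, hstat', one_mul,
      ← Finset.add_sum_erase Finset.univ r (Finset.mem_univ b)]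
    congr 2
    ext j
    simp [hSdef]
  -- The tangent bound at `p`: `w j` is the reciprocal of the derivative of the rate in `q j`, and
  -- the coefficient of `q b` is the ratio of the two partial derivatives. The gap is a perfect
  -- square.
  have hupper : ∀ j, j ≠ b →
      w j * ((θ b - θ j) ^ 2 / ((σ b : ℝ) ^ 2 / q b + (σ j : ℝ) ^ 2 / q j)) ≤
        (σ b : ℝ) ^ 2 * (p j ^ 2 / (p b ^ 2 * (σ j : ℝ) ^ 2)) * q b + q j := by
    intro j hj
    have h1 := hσ2 j
    have h2 := hσ2 b
    have h3 := hd j hj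
    have h4 := hp.pos j
    have h5 := hp.pos b
    have h6 := hq j
    have h7 := hq b
    simp only [hw]
    generalize (σ j : ℝ) ^ 2 = sj at *
    generalize (σ b : ℝ) ^ 2 = sb at *
    generalize (θ b - θ j) ^ 2 = d at *
    have e : sj * (sb / p b + sj / p j) ^ 2 / (d * (sj / p j) ^ 2) *
        (d / (sb / q b + sj / q j)) =
        (sb * p j + sj * p b) ^ 2 * (q b * q j) / (sj * p b ^ 2 * (sb * q j + sj * q b)) := by
      field_simp
    rw [e, div_le_iff₀ (by positivity)]
    have e2 : (sb * (p j ^ 2 / (p b ^ 2 * sj)) * q b + q j) *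
        (sj * p b ^ 2 * (sb * q j + sj * q b)) =
        (sb * p j ^ 2 * q b + q j * sj * p b ^ 2) * (sb * q j + sj * q b) := by
      field_simp
    rw [e2]
    have : 0 ≤ sb * sj * (p j * q b - p b * q j) ^ 2 := by positivity
    nlinarith
  -- The tangent touches at `q = p`.
  have hequal : ∀ j, j ≠ b → w j * Γ =
      (σ b : ℝ) ^ 2 * (p j ^ 2 / (p b ^ 2 * (σ j : ℝ) ^ 2)) * p b + p j := by
    intro j hj
    have h1 := hσ2 j
    have h2 := hσ2 b
    have h3 := hd j hj
    have h4 := hp.pos j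
    have h5 := hp.pos b
    rw [← hΓ j hj]
    simp only [hw]
    generalize (σ j : ℝ) ^ 2 = sj at *
    generalize (σ b : ℝ) ^ 2 = sb at *
    generalize (θ b - θ j) ^ 2 = d at *
    field_simp
  by_contra hcon
  push Not at hcon
  have hSne : S.Nonempty := by
    obtain ⟨j, hj⟩ := exists_ne b
    exact ⟨j, (hmem j).2 hj⟩
  have hlt : ∑ j ∈ S, w j * (Γ * ∑ i, q i) < ∑ j ∈ S,
      ((σ b : ℝ) ^ 2 * (p j ^ 2 / (p b ^ 2 * (σ j : ℝ) ^ 2)) * q b + q j) := by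
    refine Finset.sum_lt_sum_of_nonempty hSne fun j hj => ?_
    have hj' := (hmem j).1 hj
    exact (mul_lt_mul_of_pos_left (hcon j hj') (hwpos j hj')).trans_le (hupper j hj')
  have heq : ∑ j ∈ S, w j * (Γ * ∑ i, q i) = ∑ i, q i := by
    have : ∑ j ∈ S, w j * Γ = 1 := by
      rw [Finset.sum_congr rfl fun j hj => hequal j ((hmem j).1 hj), hsplit, hp.sum_eq_one]
    simp_rw [← mul_assoc]
    rw [← Finset.sum_mul, this, one_mul]
  rw [hsplit, heq] at hlt
  exact lt_irrefl _ hlt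

end IsBalancedAllocation

end RankingSelection

/-! ### Asymptotic rates and the comparison of two rules -/

namespace RankingSelection

variable {K : ℕ}

theorem eventually_sq_bound {γ G c : ℝ} (hG : 0 < G) (hγ : G < 2 * γ) :
    ∀ᶠ t : ℕ in atTop, (√(G * t) + 1) ^ 2 / 2 + c ≤ γ * t := by
  have hx : Tendsto (fun t : ℕ => √(G * t)) atTop atTop :=
    Real.tendsto_sqrt_atTop.comp (tendsto_natCast_atTop_atTop.const_mul_atTop hG)
  set a := γ / G - 1 / 2 with ha
  have ha0 : 0 < a := by
    rw [ha, sub_pos, lt_div_iff₀ hG]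
    linarith
  -- For `x = √(G * t) ≥ 1` with `a * x ≥ 3/2 + |c|`, the surplus `a * x^2` covers `x + 1/2 + c`.
  filter_upwards [hx.eventually_ge_atTop 1, hx.eventually_ge_atTop ((3 / 2 + |c|) / a)]
    with t h1 h2
  have hsq : √(G * t) ^ 2 = G * t := Real.sq_sqrt (by positivity)
  have hγt : γ * t = (a + 1 / 2) * √(G * t) ^ 2 := by
    rw [hsq, ha]
    field_simp
    ring
  rw [hγt]
  rw [div_le_iff₀ ha0] at h2
  nlinarith [le_abs_self c, abs_nonneg c]

section

variable {θ : Fin K → ℝ} {σ : Fin K → ℝ≥0} {b : Fin K} {h : (t : ℕ) → History K t}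

/-- If some system is sampled only finitely often, the posterior probability of misidentification
stays away from zero. -/
theorem exists_negLog_le_of_bounded (hK : 2 ≤ K) (hσ : ∀ i, 0 < σ i) (b : Fin K)
    (hmean : ∀ i, ∃ C, ∀ t, |sampleMean (h t) i| ≤ C) {i : Fin K} {n : ℕ}
    (hN : ∀ t, sampleCount (h t) i < n) :
    ∃ C : ℝ, ∀ t, negLog (posteriorMisidentification σ b (h t)) ≤ ENNReal.ofReal C := by
  have hn : (0 : ℝ≥0) < n := by exact_mod_cast (Nat.zero_le _).trans_lt (hN 0)
  -- The posterior variance of `i` never drops below this; while `i` is unsampled, this holds once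
  -- `s ≥ v₀`.
  set v₀ : ℝ≥0 := σ i ^ 2 / n with hv₀
  have hv₀pos : 0 < v₀ := div_pos (pow_pos (hσ i) 2) hn
  have hvi : ∀ t, ∀ s ≥ v₀, v₀ ≤ posteriorVariance σ s (h t) i := by
    intro t s hs
    unfold posteriorVariance
    split_ifs with h0
    · exact hs
    · have h1 : (0 : ℝ≥0) < sampleCount (h t) i := by exact_mod_cast Nat.pos_of_ne_zero h0
      have h2 : (sampleCount (h t) i : ℝ≥0) ≤ n := by exact_mod_cast (hN t).le
      exact div_le_div_of_nonneg_left zero_le h1 h2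
  obtain ⟨j, hj, hij⟩ : ∃ j, j ≠ b ∧ (i = j ∨ i = b) := by
    by_cases hib : i = b
    · have : Nontrivial (Fin K) := Fin.nontrivial_iff_two_le.2 hK
      obtain ⟨j, hj⟩ := exists_ne b
      exact ⟨j, hj, Or.inr hib⟩
    · exact ⟨i, hib, Or.inl rfl⟩
  obtain ⟨C₁, hC₁⟩ := hmean j
  obtain ⟨C₂, hC₂⟩ := hmean b
  refine ⟨((C₁ + C₂) / √(v₀ : ℝ) + 1) ^ 2 / 2 + Real.log √(2 * Real.pi), fun t =>
    negLog_posteriorMisidentification_le σ (h t) hj ?_⟩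
  filter_upwards [eventually_ge_atTop v₀] with s hs
  have hle : v₀ ≤ posteriorVariance σ s (h t) j + posteriorVariance σ s (h t) b := by
    rcases hij with rfl | rfl
    · exact (hvi t s hs).trans (le_add_of_nonneg_right zero_le)
    · exact (hvi t s hs).trans (le_add_of_nonneg_left zero_le)
  have hsqrt : 0 < √(v₀ : ℝ) := Real.sqrt_pos.2 (by exact_mod_cast hv₀pos)
  have hdiff : |sampleMean (h t) j - sampleMean (h t) b| ≤ C₁ + C₂ :=
    (abs_sub _ _).trans (add_le_add (hC₁ t) (hC₂ t))
  exact ⟨hv₀pos.trans_le hle, div_le_div₀ ((abs_nonneg _).trans hdiff) hdiff hsqrt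
    (Real.sqrt_le_sqrt (by exact_mod_cast hle))⟩

/-- `exists_rate_le` is applied to the raw counts, so the critical competitor may change with `t`.
The slack between `Γ` and `2 * γ` absorbs the error of the sample means and the lower-order terms of
the tail bound. -/
theorem eventually_negLog_le_of_tendsto (hK : 2 ≤ K) (hσ : ∀ i, 0 < σ i)
    (hb : ∀ j, j ≠ b → θ j < θ b) {p : Fin K → ℝ} (hp : IsBalancedAllocation θ σ b p) {Γ : ℝ}
    (hΓ : ∀ j, j ≠ b → (θ b - θ j) ^ 2 / ((σ b : ℝ) ^ 2 / p b + (σ j : ℝ) ^ 2 / p j) = Γ)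
    (hΓ0 : 0 < Γ) (hmean : ∀ i, Tendsto (fun t => sampleMean (h t) i) atTop (𝓝 (θ i)))
    (hN : ∀ i, Tendsto (fun t => sampleCount (h t) i) atTop atTop) {γ : ℝ} (hγ : Γ < 2 * γ) :
    ∀ᶠ t : ℕ in atTop, negLog (posteriorMisidentification σ b (h t)) ≤ ENNReal.ofReal (γ * t) := by
  obtain ⟨G, hG1, hG2⟩ := exists_between hγ
  have hG0 : 0 < G := hΓ0.trans hG1
  have hclose : ∀ᶠ t in atTop, ∀ j, j ≠ b →
      (sampleMean (h t) j - sampleMean (h t) b) ^ 2 ≤ G / Γ * (θ b - θ j) ^ 2 := by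
    rw [eventually_all]
    intro j
    by_cases hj : j = b
    · exact Eventually.of_forall fun t hne => absurd hj hne
    have h1 := ((hmean j).sub (hmean b)).pow 2
    have h2 : (θ j - θ b) ^ 2 < G / Γ * (θ b - θ j) ^ 2 := by
      have h3 : 0 < (θ b - θ j) ^ 2 := pow_pos (sub_pos.2 (hb j hj)) 2
      have h4 : 1 < G / Γ := (one_lt_div hΓ0).2 hG1
      nlinarith
    filter_upwards [h1.eventually_lt_const h2] with t ht _ using ht.le
  have hpos : ∀ᶠ t in atTop, ∀ i, 0 < sampleCount (h t) i := by
    rw [eventually_all]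
    exact fun i => (hN i).eventually_gt_atTop 0
  filter_upwards [hclose, hpos, eventually_sq_bound (c := Real.log √(2 * Real.pi)) hG0 hG2]
    with t ht hNt hbound
  have hNr : ∀ i, (0 : ℝ) < sampleCount (h t) i := fun i => by exact_mod_cast hNt i
  obtain ⟨j, hj, hrate⟩ := hp.exists_rate_le hK hσ hb hΓ hNr
  have hsum : ∑ i, (sampleCount (h t) i : ℝ) = t := by exact_mod_cast sum_sampleCount (h t)
  rw [hsum] at hrate
  refine (negLog_posteriorMisidentification_le σ (h t) hj (R := √(G * t))
    (Eventually.of_forall fun s => ?_)).trans (ENNReal.ofReal_le_ofReal hbound)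
  have hvar : ((posteriorVariance σ s (h t) j + posteriorVariance σ s (h t) b : ℝ≥0) : ℝ) =
      (σ b : ℝ) ^ 2 / sampleCount (h t) b + (σ j : ℝ) ^ 2 / sampleCount (h t) j := by
    unfold posteriorVariance
    rw [if_neg (hNt j).ne', if_neg (hNt b).ne']
    push_cast
    ring
  have hvpos : 0 < (σ b : ℝ) ^ 2 / sampleCount (h t) b +
      (σ j : ℝ) ^ 2 / sampleCount (h t) j := by
    have h1 : (0 : ℝ) < σ b := hσ b
    have h2 : (0 : ℝ) < σ j := hσ j
    have h3 := hNr b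
    have h4 := hNr j
    positivity
  refine ⟨by rw [← NNReal.coe_pos, hvar]; exact hvpos, ?_⟩
  rw [hvar]
  refine Real.le_sqrt_of_sq_le ?_
  rw [div_pow, sq_abs, Real.sq_sqrt hvpos.le]
  calc _ ≤ (G / Γ * (θ b - θ j) ^ 2) / ((σ b : ℝ) ^ 2 / sampleCount (h t) b +
        (σ j : ℝ) ^ 2 / sampleCount (h t) j) := by
        gcongr
        exact ht j hj
    _ = G / Γ * ((θ b - θ j) ^ 2 / ((σ b : ℝ) ^ 2 / sampleCount (h t) b +
        (σ j : ℝ) ^ 2 / sampleCount (h t) j)) := mul_div_assoc _ _ _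
    _ ≤ G / Γ * (Γ * t) := by gcongr
    _ = G * t := by field_simp

/-- No way of collecting the data makes the posterior probability of misidentification decay faster
than at the rate of the balanced allocation. -/
theorem eventually_negLog_le (hK : 2 ≤ K) (hσ : ∀ i, 0 < σ i) (hb : ∀ j, j ≠ b → θ j < θ b)
    {p : Fin K → ℝ} (hp : IsBalancedAllocation θ σ b p) {Γ : ℝ}
    (hΓ : ∀ j, j ≠ b → (θ b - θ j) ^ 2 / ((σ b : ℝ) ^ 2 / p b + (σ j : ℝ) ^ 2 / p j) = Γ)
    (hΓ0 : 0 < Γ) (hmono : ∀ i, Monotone fun t => sampleCount (h t) i)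
    (hn : ∀ i, ∀ ε : ℝ, 0 < ε → ∃ C, ∀ t,
      |noiseSum (θ i) (h t) i| ≤ C + ε * sampleCount (h t) i)
    {γ : ℝ} (hγ : Γ < 2 * γ) :
    ∀ᶠ t : ℕ in atTop, negLog (posteriorMisidentification σ b (h t)) ≤ ENNReal.ofReal (γ * t) := by
  by_cases hN : ∀ i, Tendsto (fun t => sampleCount (h t) i) atTop atTop
  · exact eventually_negLog_le_of_tendsto hK hσ hb hp hΓ hΓ0
      (fun i => tendsto_sampleMean (hn i) (hN i)) hN hγ
  · push Not at hN
    obtain ⟨i, hi⟩ := hN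
    -- A monotone count that does not diverge is bounded.
    have hbdd : ∃ n, ∀ t, sampleCount (h t) i < n := by
      by_contra hcon
      push Not at hcon
      exact hi (tendsto_atTop_atTop_of_monotone (hmono i) hcon)
    obtain ⟨n, hn'⟩ := hbdd
    obtain ⟨C, hC⟩ := exists_negLog_le_of_bounded hK hσ b
      (fun i => exists_abs_sampleMean_le (hn i)) hn'
    have hγ0 : 0 < γ := by linarith
    have hlin : Tendsto (fun t : ℕ => γ * (t : ℝ)) atTop atTop :=
      tendsto_natCast_atTop_atTop.const_mul_atTop hγ0
    filter_upwards [hlin.eventually_ge_atTop C] with t ht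
    exact (hC t).trans (ENNReal.ofReal_le_ofReal ht)

/-- If the empirical allocation converges to one whose pairwise rates all equal `Γ`, then the
posterior probability of misidentification decays at least at the rate `Γ / 2`. -/
theorem eventually_le_negLog (hσ : ∀ i, 0 < σ i) (hb : ∀ j, j ≠ b → θ j < θ b)
    {p : Fin K → ℝ} (hp : ∀ i, 0 < p i) {Γ : ℝ}
    (hΓ : ∀ j, j ≠ b → (θ b - θ j) ^ 2 / ((σ b : ℝ) ^ 2 / p b + (σ j : ℝ) ^ 2 / p j) = Γ)
    (hn : ∀ i, ∀ ε : ℝ, 0 < ε → ∃ C, ∀ t,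
      |noiseSum (θ i) (h t) i| ≤ C + ε * sampleCount (h t) i)
    (hlim : Tendsto (fun t => empiricalAllocation (h t)) atTop (𝓝 p))
    {γ : ℝ} (hγ : 2 * γ < Γ) :
    ∀ᶠ t : ℕ in atTop, ENNReal.ofReal (γ * t) ≤ negLog (posteriorMisidentification σ b (h t)) := by
  have hlim' : ∀ i, Tendsto (fun t : ℕ => (sampleCount (h t) i : ℝ) / t) atTop (𝓝 (p i)) :=
    fun i => (tendsto_pi_nhds.1 hlim) i
  have hN : ∀ i, Tendsto (fun t => sampleCount (h t) i) atTop atTop := by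
    intro i
    rw [← tendsto_natCast_atTop_iff (R := ℝ)]
    refine ((hlim' i).pos_mul_atTop (hp i)
      (tendsto_natCast_atTop_atTop (R := ℝ))).congr' ?_
    filter_upwards [eventually_gt_atTop 0] with t ht
    have : (t : ℝ) ≠ 0 := by exact_mod_cast ht.ne'
    field_simp
  have hmean : ∀ i, Tendsto (fun t => sampleMean (h t) i) atTop (𝓝 (θ i)) :=
    fun i => tendsto_sampleMean (hn i) (hN i)
  obtain ⟨G, hG1, hG2⟩ := exists_between hγ
  have hgood : ∀ᶠ t : ℕ in atTop, ∀ j, j ≠ b → sampleMean (h t) j ≤ sampleMean (h t) b ∧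
      G ≤ (sampleMean (h t) j - sampleMean (h t) b) ^ 2 /
        ((σ j : ℝ) ^ 2 / (sampleCount (h t) j / t) +
          (σ b : ℝ) ^ 2 / (sampleCount (h t) b / t)) := by
    rw [eventually_all]
    intro j
    by_cases hj : j = b
    · exact Eventually.of_forall fun t hne => absurd hj hne
    have hden : 0 < (σ j : ℝ) ^ 2 / p j + (σ b : ℝ) ^ 2 / p b := by
      have h1 : (0 : ℝ) < σ b := hσ b
      have h2 : (0 : ℝ) < σ j := hσ j
      have h3 := hp b
      have h4 := hp j
      positivity
    have h1 := (((hmean j).sub (hmean b)).pow 2).div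
      (((tendsto_const_nhds (x := (σ j : ℝ) ^ 2)).div (hlim' j) (hp j).ne').add
        ((tendsto_const_nhds (x := (σ b : ℝ) ^ 2)).div (hlim' b) (hp b).ne')) hden.ne'
    have h2 : (θ j - θ b) ^ 2 / ((σ j : ℝ) ^ 2 / p j + (σ b : ℝ) ^ 2 / p b) = Γ := by
      rw [← hΓ j hj, add_comm, ← neg_sq, neg_sub]
    rw [h2] at h1
    filter_upwards [h1.eventually_const_lt hG2, (hmean j).eventually_lt (hmean b) (hb j hj)]
      with t h3 h4 _ using ⟨h4.le, h3.le⟩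
  have hpos : ∀ᶠ t in atTop, ∀ i, 0 < sampleCount (h t) i := by
    rw [eventually_all]
    exact fun i => (hN i).eventually_gt_atTop 0
  -- This linear surplus eventually pays for the union-bound loss `Real.log K`.
  have hG3 : 0 < G / 2 - γ := by linarith
  filter_upwards [hgood, hpos, eventually_gt_atTop 0, (tendsto_natCast_atTop_atTop.const_mul_atTop
    hG3).eventually_ge_atTop (Real.log K)] with t ht hNt ht0 hlog
  have htr : (0 : ℝ) < t := by exact_mod_cast ht0
  have hNr : ∀ i, (0 : ℝ) < sampleCount (h t) i := fun i => by exact_mod_cast hNt i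
  refine le_trans (ENNReal.ofReal_le_ofReal ?_) (le_negLog_posteriorMisidentification σ hσ (h t)
    (fun i => (hNt i).ne') (x := G / 2 * t) (fun j hj => (ht j hj).1) fun j hj => ?_)
  · linarith
  · have h1 := (ht j hj).2
    have h2 : (0 : ℝ) < σ b := hσ b
    have h3 : (0 : ℝ) < σ j := hσ j
    have h4 := hNr b
    have h5 := hNr j
    have e : (sampleMean (h t) j - sampleMean (h t) b) ^ 2 /
        (2 * ((σ j : ℝ) ^ 2 / sampleCount (h t) j + (σ b : ℝ) ^ 2 / sampleCount (h t) b)) =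
        (sampleMean (h t) j - sampleMean (h t) b) ^ 2 /
        ((σ j : ℝ) ^ 2 / (sampleCount (h t) j / t) +
          (σ b : ℝ) ^ 2 / (sampleCount (h t) b / t)) / 2 * t := by
      generalize (sampleMean (h t) j - sampleMean (h t) b) ^ 2 = d
      field_simp
    rw [e]
    gcongr

end

/-- Two sequences with linear growth at asymptotically the same rate. -/
theorem one_le_liminf_div {f g : ℕ → ℝ≥0∞} {r : ℝ} (hr : 0 < r)
    (hf : ∀ γ, γ < r → ∀ᶠ t : ℕ in atTop, ENNReal.ofReal (γ * t) ≤ f t)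
    (hg : ∀ γ, r < γ → ∀ᶠ t : ℕ in atTop, g t ≤ ENNReal.ofReal (γ * t)) :
    1 ≤ liminf (fun t => f t / g t) atTop := by
  refine le_of_forall_lt fun c hc => ?_
  obtain ⟨c', hcc', hc'⟩ := exists_between hc
  refine hcc'.trans_le (le_liminf_of_le (by isBoundedDefault) ?_)
  have hx1 : c'.toReal < 1 := by
    rw [← ENNReal.toReal_one]
    exact (ENNReal.toReal_lt_toReal hc'.ne_top ENNReal.one_ne_top).2 hc'
  have hx0 : 0 ≤ c'.toReal := ENNReal.toReal_nonneg
  have hcx : c' = ENNReal.ofReal c'.toReal := (ENNReal.ofReal_toReal hc'.ne_top).symm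
  set x := c'.toReal
  -- The two rates straddle `r`, and their ratio `((1 + x) / 2)^2` is at least `x` because `(1 -
  -- x)^2 ≥ 0`.
  have h1 : r * ((1 + x) / 2) < r := by nlinarith
  have h2 : r < r * (2 / (1 + x)) := by
    have : 1 < 2 / (1 + x) := by rw [lt_div_iff₀ (by linarith)]; linarith
    nlinarith
  filter_upwards [hf _ h1, hg _ h2, eventually_gt_atTop 0] with t hft hgt ht
  have htr : (0 : ℝ) < t := by exact_mod_cast ht
  have hf0 : f t ≠ 0 := (lt_of_lt_of_le (ENNReal.ofReal_pos.2 (by positivity)) hft).ne'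
  have hgtop : g t ≠ ⊤ := ne_top_of_le_ne_top ENNReal.ofReal_ne_top hgt
  rw [ENNReal.le_div_iff_mul_le (Or.inr hf0) (Or.inl hgtop)]
  calc c' * g t ≤ ENNReal.ofReal x * ENNReal.ofReal (r * (2 / (1 + x)) * t) := by
        rw [hcx]
        gcongr
    _ = ENNReal.ofReal (x * (r * (2 / (1 + x)) * t)) := (ENNReal.ofReal_mul hx0).symm
    _ ≤ ENNReal.ofReal (r * ((1 + x) / 2) * t) := by
        refine ENNReal.ofReal_le_ofReal ?_
        have : x * (2 / (1 + x)) ≤ (1 + x) / 2 := by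
          rw [← mul_div_assoc, div_le_iff₀ (by linarith)]
          nlinarith [sq_nonneg (1 - x)]
        calc x * (r * (2 / (1 + x)) * t) = r * t * (x * (2 / (1 + x))) := by ring
          _ ≤ r * t * ((1 + x) / 2) := by gcongr
          _ = r * ((1 + x) / 2) * t := by ring
    _ ≤ f t := hft

/-- Each almost sure event needed concerns only one of the two experiments, so it passes to any
coupling through the marginals. -/
theorem IsBalancedAllocation.isAsymptoticallyOptimal (hK : 2 ≤ K) {θ : Fin K → ℝ}
    {σ : Fin K → ℝ≥0} (hσ : ∀ i, 0 < σ i) {b : Fin K} (hb : ∀ j, j ≠ b → θ j < θ b)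
    {p : Fin K → ℝ} (hp : IsBalancedAllocation θ σ b p) {A : AllocationRule K}
    (hA : ∀ᵐ ω ∂(A.law σ), Tendsto
      (fun t : ℕ => empiricalAllocation (A.history θ t ω)) atTop (𝓝 p)) :
    IsAsymptoticallyOptimal θ σ b A := by
  intro B Q hQA hQB
  have : Nontrivial (Fin K) := Fin.nontrivial_iff_two_le.2 hK
  obtain ⟨k, hk⟩ := exists_ne b
  set Γ := (θ b - θ k) ^ 2 / ((σ b : ℝ) ^ 2 / p b + (σ k : ℝ) ^ 2 / p k) with hΓdef
  have hΓ : ∀ j, j ≠ b →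
      (θ b - θ j) ^ 2 / ((σ b : ℝ) ^ 2 / p b + (σ j : ℝ) ^ 2 / p j) = Γ :=
    fun j hj => hp.information_balance j k hj hk
  have hΓ0 : 0 < Γ := by
    have h1 : (0 : ℝ) < σ b := hσ b
    have h2 : (0 : ℝ) < σ k := hσ k
    have h3 := hp.pos b
    have h4 := hp.pos k
    have h5 : 0 < θ b - θ k := sub_pos.2 (hb k hk)
    positivity
  have hAn := A.ae_abs_noiseSum_le θ σ hσ
  have hBn := B.ae_abs_noiseSum_le θ σ hσ
  rw [← hQA] at hA hAn
  rw [← hQB] at hBn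
  filter_upwards [ae_of_ae_map measurable_fst.aemeasurable hA,
    ae_of_ae_map measurable_fst.aemeasurable hAn,
    ae_of_ae_map measurable_snd.aemeasurable hBn] with ω hlim hnA hnB
  refine one_le_liminf_div (half_pos hΓ0) (fun γ hγ => ?_) fun γ hγ => ?_
  · exact eventually_le_negLog hσ hb hp.pos hΓ hnA hlim (by linarith)
  · exact eventually_negLog_le hK hσ hb hp hΓ hΓ0 (B.monotone_sampleCount θ ω.2) hnB
      (by linarith)

end RankingSelection

theorem theorem1 (K : ℕ) (hK : 2 ≤ K) (θ : Fin K → ℝ) (σ : Fin K → ℝ≥0) (hσ : ∀ i, 0 < σ i)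
    (b : Fin K) (hb : ∀ j, j ≠ b → θ j < θ b) :
    (∃! p : Fin K → ℝ, RankingSelection.IsBalancedAllocation θ σ b p) ∧
      ∀ p : Fin K → ℝ, RankingSelection.IsBalancedAllocation θ σ b p →
        ∀ A : RankingSelection.AllocationRule K,
          (∀ᵐ ω ∂(A.law σ), Tendsto
            (fun t : ℕ => RankingSelection.empiricalAllocation (A.history θ t ω)) atTop (𝓝 p)) →
          RankingSelection.IsAsymptoticallyOptimal θ σ b A := by
  refine ⟨?_, fun p hp A hA => hp.isAsymptoticallyOptimal hK hσ hb hA⟩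
  obtain ⟨p, hp⟩ := RankingSelection.exists_isBalancedAllocation hK θ σ hσ b hb
  exact ⟨p, hp, fun q hq => hq.unique hK hσ hb hp⟩
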